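/- Let $a\in\mathbb C$, $a\neq 0$, and let $$\mathcal L_{a,\pi/2}f(z)=z^2f''(z)+(2z-a)f'(z)+\tfrac{\pi^2}{4}z^2f(z).$$ Let $g$ be an eigenfunction of $\mathcal L_{a,\pi/2}$, that is, a function holomorphic in a neighbourhood of $0$, not identically zero there, with $\mathcal L_{a,\pi/2}g=\lambda g$ near $0$ for some $\lambda\in\mathbb C$. Then $g$ extends to an entire function, still denoted by $g$. Let $\mathcal Z(g)$ denote the set of zeros in $\mathbb C$ of this entire function, counted with multiplicity. Let $PW^1$ denote the space of entire functions $f$ of exponential type at most $\pi$ (for every $\varepsilon>0$ there is $C$ such that $|f(z)|\le Ce^{(\pi+\varepsilon)|z|}$ for all $z\in\mathbb C$) whose restriction to the real line belongs to $L^1(\mathbb R)$. Then for every $f\in PW^1$ the summation formula $$a f'(0)=\sum_{\mu\in\mathcal Z(g)}\big(f(\mu)-f(-\mu)\big)$$ holds, where the series converges absolutely (so that the order of summation does not matter). -/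

import Mathlib

open Filter Topology

/-- The differential operator `(𝓛_{a,b} f)(z) = z² f''(z) + (2z - a) f'(z) + b² z² f(z)`. -/
noncomputable def opL (a b : ℂ) (f : ℂ → ℂ) (z : ℂ) : ℂ :=
  z ^ 2 * iteratedDeriv 2 f z + (2 * z - a) * deriv f z + b ^ 2 * z ^ 2 * f z

/-- `g` is an eigenfunction of `𝓛_{a,b}`: it is holomorphic in a neighbourhood of `0`, it does not
vanish identically near `0`, and for some `ev : ℂ` it solves `𝓛_{a,b} g = ev * g` near `0`. -/
def IsEigenfunction (a b : ℂ) (g : ℂ → ℂ) : Prop :=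
  AnalyticAt ℂ g 0 ∧ (¬ ∀ᶠ z in 𝓝 (0 : ℂ), g z = 0) ∧
    ∃ ev : ℂ, ∀ᶠ z in 𝓝 (0 : ℂ), opL a b g z = ev * g z

/-- `f` has exponential type at most `t`. -/
def HasExpTypeAtMost (t : ℝ) (f : ℂ → ℂ) : Prop :=
  ∀ ε : ℝ, 0 < ε → ∃ C : ℝ, ∀ z : ℂ, ‖f z‖ ≤ C * Real.exp ((t + ε) * ‖z‖)

/-- The Paley-Wiener space `PW¹`: entire functions of exponential type at most `π` whose
restriction to the real line is integrable. -/
def IsPW1 (f : ℂ → ℂ) : Prop :=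
  Differentiable ℂ f ∧ HasExpTypeAtMost Real.pi f ∧
    MeasureTheory.Integrable (fun x : ℝ => f (x : ℂ)) MeasureTheory.volume

open Filter Topology MeasureTheory

/-! For an entire eigenfunction G, the differential equations at z and at -z combine into the
identity `wronskian_const`: a G(z)G(-z) - z²(G'(z)G(-z) + G(z)G'(-z)) = a G(0)². The constant is
nonzero, so all zeros of G are simple, and division by z² G(z)G(-z) gives a/z² - G'(z)/G(z) -
G'(-z)/G(-z) = a G(0)² / (z² G(z)G(-z)). Multiplied by f and integrated over a circle, the left side
yields a f'(0) minus the sum of f(μ) - f(-μ) over the enclosed zeros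
(`sum_zeros_sub_eq_circleIntegral`). The formula therefore reduces to the decay of the integral of
the right side.

That decay needs lower bounds for G. With b = π/2, u(z) = z G(z) satisfies u'' + b²u = 0 up to a
perturbation with coefficients O(|z|⁻²), so 2ib u(z) resembles p e^{ibz} - q e^{-ibz} at infinity
(`exists_hasAmplitudes`, `exists_trig_approx`). The Wronskian identity forces p² ≠ q², and a
Phragmén–Lindelöf and Liouville argument shows that neither amplitude vanishes (`incoming_ne_zero`,
`outgoing_ne_zero`). Hence the zeros lie in a horizontal strip, and |u| ≥ c e^{b|Im z|} on a
sequence of circles (`exists_circles`). As 2b = π, the product u(z)u(-z) absorbs exactly the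
exponential growth of f, and the integral tends to 0 whenever f has an additional factor |z|⁻²
(`tendsto_sum_zerosIn`).

For general f both sides pass to the limit. The zeros are uniformly separated (`exists_separation`),
so the Plancherel–Pólya inequality bounds the sum of |f(μ)| by the L¹ norm
(`sum_norm_le_of_separated`); this also gives absolute convergence. `IsPW1.exists_approx` supplies
approximants with the required decay.

That g extends to an entire function is read off the Taylor recurrence: its solutions either grow
factorially or decay faster than any geometric sequence (`bounded_of_recurrence`). -/

/-! ### Taylor coefficients and entire extension -/

theorem AnalyticAt.eventually_hasDerivAt_iteratedDeriv {g : ℂ → ℂ} {c : ℂ} (hg : AnalyticAt ℂ g c) :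
    ∀ᶠ z in 𝓝 c, ∀ n : ℕ, HasDerivAt (iteratedDeriv n g) (iteratedDeriv (n + 1) g z) z := by
  filter_upwards [hg.eventually_analyticAt] with z hz n
  rw [iteratedDeriv_succ]
  rw [iteratedDeriv_eq_iterate]
  exact (hz.iterated_deriv n).differentiableAt.hasDerivAt

/-- Leibniz rule for the eigenvalue equation. The truncated subtractions are harmless: the factors n
and n(n - 1) vanish wherever truncation occurs. -/
theorem eigen_iteratedDeriv {a b ev : ℂ} {g : ℂ → ℂ} (hg : AnalyticAt ℂ g 0)
    (h : ∀ᶠ z in 𝓝 (0 : ℂ), opL a b g z = ev * g z) (n : ℕ) :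
    ∀ᶠ z in 𝓝 (0 : ℂ), z ^ 2 * iteratedDeriv (n + 2) g z
      + (2 * (n + 1) * z - a) * iteratedDeriv (n + 1) g z
      + (n * (n + 1) - ev + b ^ 2 * z ^ 2) * iteratedDeriv n g z
      + 2 * n * b ^ 2 * z * iteratedDeriv (n - 1) g z
      + n * (n - 1) * b ^ 2 * iteratedDeriv (n - 2) g z = 0 := by
  induction n with
  | zero =>
    filter_upwards [h] with z hz
    simp only [opL] at hz
    simp [iteratedDeriv_one]
    linear_combination hz
  | succ n ih =>
    filter_upwards [ih.eventually_nhds, hg.eventually_hasDerivAt_iteratedDeriv] with z h1 h2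
    have hid : HasDerivAt (fun z : ℂ => z) 1 z := hasDerivAt_id z
    have hd := (((((hid.pow 2).mul (h2 (n + 2))).add
      (((hid.const_mul (2 * ((n : ℂ) + 1))).sub_const a).mul (h2 (n + 1)))).add
      ((((hid.pow 2).const_mul (b ^ 2)).const_add ((n : ℂ) * (n + 1) - ev)).mul (h2 n))).add
      ((hid.const_mul (2 * (n : ℂ) * b ^ 2)).mul (h2 (n - 1)))).add
      ((h2 (n - 2)).const_mul ((n : ℂ) * (n - 1) * b ^ 2))
    have h0 := hd.unique ((hasDerivAt_const z (0 : ℂ)).congr_of_eventuallyEq h1)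
    rcases n with _ | _ | n
    · simp at h0 ⊢
      linear_combination h0
    · simp at h0 ⊢
      linear_combination h0
    · simp only [Pi.pow_apply, show n + 1 + 1 - 1 = n + 1 from rfl, show n + 1 + 1 - 2 = n from rfl,
        show n + 1 + 1 + 1 - 1 = n + 2 from rfl, show n + 1 + 1 + 1 - 2 = n + 1 from rfl] at h0 ⊢
      push_cast at h0 ⊢
      linear_combination h0

theorem eigen_coeff {a b ev : ℂ} {g : ℂ → ℂ} (hg : AnalyticAt ℂ g 0)
    (h : ∀ᶠ z in 𝓝 (0 : ℂ), opL a b g z = ev * g z) (n : ℕ) :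
    a * iteratedDeriv (n + 1) g 0 = (n * (n + 1) - ev) * iteratedDeriv n g 0
      + n * (n - 1) * b ^ 2 * iteratedDeriv (n - 2) g 0 := by
  have := (eigen_iteratedDeriv hg h n).self_of_nhds
  simp at this
  linear_combination -this

/-- Running-maximum principle: a sequence of at most geometric growth satisfying a strongly
dominated recursive inequality is bounded. -/
theorem bounded_of_recurrence {s : ℕ → ℝ} {R A C : ℝ} {N : ℕ} (hR : 0 < R) (hA : 0 < A)
    (hA2 : 2 * A ≤ 1) (hAR : 2 * A * R < 1) (hs0 : ∀ n, 0 ≤ s n) (hgeo : ∀ n, s n ≤ C * R ^ n)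
    (hrec : ∀ n, N ≤ n → s n ≤ A * s (n + 1) + s (n - 2) / 2) : ∃ M, ∀ n, s n ≤ M := by
  obtain ⟨T, hT⟩ : ∃ T, ∀ n < N, s n ≤ T := by
    refine ⟨∑ i ∈ Finset.range N, s i, fun n hn => ?_⟩
    exact Finset.single_le_sum (f := s) (fun i _ => hs0 i) (Finset.mem_range.2 hn)
  by_contra! hcon
  have hex : ∃ n, max T 0 < s n := hcon _
  classical
  -- T bounds s below index N, and m is the first index where s exceeds T and 0. From m on, s (n -
  -- 2) / 2 can be absorbed into the left side, so s grows by a factor of at least 1/(2A) at each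
  -- step. This outpaces R ^ n because 2AR < 1.
  set m := Nat.find hex with hm
  have hmT : max T 0 < s m := Nat.find_spec hex
  have hlt : ∀ j < m, s j ≤ s m := fun j hj => (not_lt.1 (Nat.find_min hex hj)).trans hmT.le
  have hmN : N ≤ m := by
    by_contra! h
    exact absurd ((hT m h).trans (le_max_left _ 0)) (not_le.2 hmT)
  have key : ∀ k : ℕ, (∀ j ≤ m + k, s j ≤ s (m + k)) ∧ s m ≤ (2 * A) ^ k * s (m + k) := by
    intro k
    induction k with
    | zero =>
      refine ⟨fun j hj => ?_, by simp⟩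
      rcases hj.lt_or_eq with h | h
      · exact hlt j h
      · rw [h]
    | succ k ih =>
      have h1 := hrec (m + k) (by omega)
      have h2 := ih.1 (m + k - 2) (by omega)
      have h3 : s (m + k) ≤ 2 * A * s (m + (k + 1)) := by
        rw [← add_assoc]; linarith
      have h4 : s (m + k) ≤ s (m + (k + 1)) := by nlinarith [hs0 (m + (k + 1))]
      refine ⟨fun j hj => ?_, ?_⟩
      · rcases hj.lt_or_eq with h | h
        · exact (ih.1 j (by omega)).trans h4
        · rw [h]
      · calc s m ≤ (2 * A) ^ k * s (m + k) := ih.2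
          _ ≤ (2 * A) ^ k * (2 * A * s (m + (k + 1))) := by gcongr
          _ = _ := by ring
  have hbd : ∀ k : ℕ, s m ≤ C * R ^ m * (2 * A * R) ^ k := fun k => by
    calc s m ≤ (2 * A) ^ k * s (m + k) := (key k).2
      _ ≤ (2 * A) ^ k * (C * R ^ (m + k)) := by gcongr; exact hgeo _
      _ = _ := by rw [mul_pow, pow_add]; ring
  have hlim : Tendsto (fun k : ℕ => C * R ^ m * (2 * A * R) ^ k) atTop (𝓝 (C * R ^ m * 0)) :=
    (tendsto_pow_atTop_nhds_zero_of_lt_one (by positivity) hAR).const_mul _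
  have := ge_of_tendsto' hlim hbd
  linarith [le_max_right T 0]

/-- The recurrence is solved for c n rather than c (n + 1): since n(n + 1) - ev dominates, c n is
controlled by O(1/n) c (n + 1) and O(1/n²) c (n - 2). Weighted by r ^ n, this fits
`bounded_of_recurrence`, and some positive radius of convergence becomes an infinite one. -/
theorem eigen_coeff_bounded {a b ev : ℂ} {c : ℕ → ℂ} {C R : ℝ} (hR : 0 < R)
    (hgeo : ∀ n, ‖c n‖ ≤ C * R ^ n)
    (hrec : ∀ n : ℕ, 2 ≤ n → a * (n + 1) * c (n + 1) = (n * (n + 1) - ev) * c n + b ^ 2 * c (n - 2))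
    {r : ℝ} (hr : 0 < r) : ∃ M, ∀ n, ‖c n‖ * r ^ n ≤ M := by
  -- Chosen so that both 2A ≤ 1 and 2A(Rr) < 1.
  set A : ℝ := 1 / (2 * (1 + R * r) + 1) with hAdef
  have hA : 0 < A := by positivity
  have hA2 : 2 * A ≤ 1 := by
    rw [hAdef, mul_one_div, div_le_one (by positivity)]; nlinarith [mul_pos hR hr]
  have hAR : 2 * A * (R * r) < 1 := by
    rw [hAdef, mul_one_div, div_mul_eq_mul_div, div_lt_one (by positivity)]; nlinarith [mul_pos hR hr]
  -- For n ≥ N the summands ensure, in order: n ≥ 2; ‖ev‖ ≤ n(n + 1)/2; the coefficient of the term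
  -- in c (n + 1) is at most A; that of the term in c (n - 2) is at most 1/2.
  obtain ⟨N, hN⟩ := exists_nat_gt (2 + 2 * ‖ev‖ + 2 * ‖a‖ / (A * r) + 4 * ‖b‖ ^ 2 * r ^ 2)
  have h0 : 0 ≤ 2 * ‖a‖ / (A * r) := by positivity
  have h0' : 0 ≤ 4 * ‖b‖ ^ 2 * r ^ 2 := by positivity
  refine bounded_of_recurrence (N := N) (mul_pos hR hr) hA hA2 hAR (fun n => by positivity)
    (C := C) (fun n => ?_) (fun n hn => ?_)
  · rw [mul_pow, ← mul_assoc]; gcongr; exact hgeo n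
  have hnN : (N : ℝ) ≤ n := by exact_mod_cast hn
  have hn2 : 2 ≤ n := by
    have : (2 : ℝ) ≤ n := by linarith [norm_nonneg ev]
    exact_mod_cast this
  obtain ⟨k, rfl⟩ : ∃ k, n = k + 2 := ⟨n - 2, by omega⟩
  have hk : (0 : ℝ) ≤ k := k.cast_nonneg
  push_cast at hnN
  have hev : ‖ev‖ ≤ ((k : ℝ) + 2) * (k + 2 + 1) / 2 := by nlinarith [norm_nonneg ev]
  have h1 : ((k : ℝ) + 2) * (k + 2 + 1) / 2 ≤ ‖((k : ℂ) + 2) * (k + 2 + 1) - ev‖ := by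
    have e1 : ‖((k : ℂ) + 2) * (k + 2 + 1)‖ = ((k : ℝ) + 2) * (k + 2 + 1) := by
      rw [show ((k : ℂ) + 2) * (k + 2 + 1) = (((k + 2) * (k + 2 + 1) : ℝ) : ℂ) by push_cast; ring]
      exact Complex.norm_of_nonneg (by positivity)
    have := norm_sub_norm_le (((k : ℂ) + 2) * (k + 2 + 1)) ev
    linarith
  have h2 := hrec (k + 2) hn2
  simp only [Nat.add_sub_cancel] at h2 ⊢
  push_cast at h2
  have h3 : ‖((k : ℂ) + 2) * (k + 2 + 1) - ev‖ * ‖c (k + 2)‖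
      ≤ ‖a‖ * (k + 2 + 1) * ‖c (k + 2 + 1)‖ + ‖b‖ ^ 2 * ‖c k‖ := by
    rw [← norm_mul, show (((k : ℂ) + 2) * (k + 2 + 1) - ev) * c (k + 2)
      = a * (k + 2 + 1) * c (k + 2 + 1) - b ^ 2 * c k by linear_combination -h2]
    refine (norm_sub_le _ _).trans (le_of_eq ?_)
    rw [norm_mul, norm_mul, norm_mul, norm_pow,
      show ((k : ℂ) + 2 + 1) = ((k + 2 + 1 : ℝ) : ℂ) by push_cast; ring,
      Complex.norm_of_nonneg (by positivity)]
  have h4 : ((k : ℝ) + 2) * (k + 2 + 1) / 2 * ‖c (k + 2)‖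
      ≤ ‖a‖ * (k + 2 + 1) * ‖c (k + 2 + 1)‖ + ‖b‖ ^ 2 * ‖c k‖ :=
    (mul_le_mul_of_nonneg_right h1 (norm_nonneg _)).trans h3
  have h5 : 2 * ‖a‖ ≤ A * r * (k + 2) := by
    have : 2 * ‖a‖ / (A * r) ≤ k + 2 := by linarith [norm_nonneg ev]
    rw [div_le_iff₀ (by positivity)] at this
    linarith
  have h6 : 4 * ‖b‖ ^ 2 * r ^ 2 ≤ k + 2 := by linarith [norm_nonneg ev]
  have h7 : ‖c (k + 2)‖ ≤ A * r * ‖c (k + 2 + 1)‖ + 2 * ‖b‖ ^ 2 / ((k : ℝ) + 2) * ‖c k‖ := by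
    have hp : (0 : ℝ) < (k + 2) * (k + 2 + 1) / 2 := by positivity
    refine le_of_mul_le_mul_left (h4.trans ?_) hp
    refine (add_le_add ?_ ?_).trans_eq (mul_add _ _ _).symm
    · calc ‖a‖ * (k + 2 + 1) * ‖c (k + 2 + 1)‖
          = (2 * ‖a‖) * ((k + 2 + 1) / 2 * ‖c (k + 2 + 1)‖) := by ring
        _ ≤ (A * r * (k + 2)) * ((k + 2 + 1) / 2 * ‖c (k + 2 + 1)‖) := by gcongr
        _ = _ := by ring
    · have : ((k : ℝ) + 2) * (k + 2 + 1) / 2 * (2 * ‖b‖ ^ 2 / ((k : ℝ) + 2) * ‖c k‖)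
          = (k + 2 + 1) * (‖b‖ ^ 2 * ‖c k‖) := by field_simp
      rw [this]
      have : 0 ≤ ‖b‖ ^ 2 * ‖c k‖ := by positivity
      nlinarith
  calc ‖c (k + 2)‖ * r ^ (k + 2)
      ≤ (A * r * ‖c (k + 2 + 1)‖ + 2 * ‖b‖ ^ 2 / ((k : ℝ) + 2) * ‖c k‖) * r ^ (k + 2) := by gcongr
    _ = A * (‖c (k + 2 + 1)‖ * r ^ (k + 2 + 1))
        + (4 * ‖b‖ ^ 2 * r ^ 2 / (k + 2)) * (‖c k‖ * r ^ k / 2) := by ring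
    _ ≤ A * (‖c (k + 2 + 1)‖ * r ^ (k + 2 + 1)) + 1 * (‖c k‖ * r ^ k / 2) := by
        gcongr
        rw [div_le_one (by positivity)]
        exact h6
    _ = _ := by ring

/-- The Taylor series at `0` of an eigenfunction has infinite radius of convergence. -/
theorem IsEigenfunction.exists_entire {a b : ℂ} {g : ℂ → ℂ} (hg : IsEigenfunction a b g) :
    ∃ G : ℂ → ℂ, Differentiable ℂ G ∧ G =ᶠ[𝓝 0] g := by
  obtain ⟨hga, -, ev, hev⟩ := hg
  have hfp := hga.hasFPowerSeriesAt
  set c : ℕ → ℂ := fun n => iteratedDeriv n g 0 / n.factorial with hc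
  set p := FormalMultilinearSeries.ofScalars ℂ c with hp
  have hnorm : ∀ n, ‖p n‖ = ‖c n‖ := fun n => by simp [hp]
  obtain ⟨r, hr0, hr⟩ := ENNReal.lt_iff_exists_nnreal_btwn.1 hfp.radius_pos
  obtain ⟨C, hC, hbd⟩ := p.norm_le_div_pow_of_pos_of_lt_radius (by exact_mod_cast hr0) hr
  have hrad : p.radius = ⊤ := by
    refine ENNReal.eq_top_of_forall_nnreal_le fun ρ => ?_
    rcases eq_or_ne ρ 0 with rfl | hρ
    · simp
    obtain ⟨M, hM⟩ := eigen_coeff_bounded (a := a) (b := b) (ev := ev) (c := c) (C := C)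
      (R := (r : ℝ)⁻¹) (by simpa using hr0) (fun n => by
        rw [← hnorm, inv_pow, ← div_eq_mul_inv]; exact hbd n) (fun n hn => by
          obtain ⟨k, rfl⟩ : ∃ k, n = k + 2 := ⟨n - 2, by omega⟩
          have h := eigen_coeff hga hev (k + 2)
          simp only [Nat.add_sub_cancel, hc] at h ⊢
          have hf : (k.factorial : ℂ) ≠ 0 := by exact_mod_cast k.factorial_ne_zero
          have h1 : (k : ℂ) + 1 ≠ 0 := by exact_mod_cast k.succ_ne_zero
          have h2 : (k : ℂ) + 1 + 1 ≠ 0 := by exact_mod_cast (k + 1).succ_ne_zero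
          have h3 : (k : ℂ) + 1 + 1 + 1 ≠ 0 := by exact_mod_cast (k + 2).succ_ne_zero
          rw [Nat.factorial_succ (k + 2), Nat.factorial_succ (k + 1), Nat.factorial_succ k]
          push_cast at h ⊢
          rw [show (k : ℂ) + 2 = k + 1 + 1 by ring] at *
          field_simp
          linear_combination h) (r := ρ) (by positivity)
    exact p.le_radius_of_bound M fun n => by rw [hnorm]; exact hM n
  have hball := p.hasFPowerSeriesOnBall (by rw [hrad]; exact ENNReal.zero_lt_top)
  refine ⟨p.sum, fun z => (hball.analyticAt_of_mem (by simp [hrad])).differentiableAt, ?_⟩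
  obtain ⟨s, hs⟩ := hfp
  filter_upwards [Metric.eball_mem_nhds (0 : ℂ) hs.r_pos] with z hz
  simpa using (hs.sum hz).symm

/-- As a ≠ 0, the recurrence determines every Taylor coefficient from the zeroth one. -/
theorem IsEigenfunction.apply_zero_ne {a b : ℂ} (ha : a ≠ 0) {g : ℂ → ℂ} (hg : IsEigenfunction a b g) :
    g 0 ≠ 0 := by
  obtain ⟨hga, hne, ev, hev⟩ := hg
  intro h0
  have hall : ∀ n, iteratedDeriv n g 0 = 0 := by
    intro n
    induction n using Nat.strong_induction_on with
    | _ n ih =>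
      rcases n with _ | n
      · simpa using h0
      · have h := eigen_coeff hga hev n
        rw [ih n (by omega), ih (n - 2) (by omega)] at h
        simpa [ha] using h
  apply hne
  have hz : (FormalMultilinearSeries.ofScalars ℂ fun n => iteratedDeriv n g 0 / (n.factorial : ℂ)) = 0 := by
    ext n
    simp [hall]
  have hfp := hga.hasFPowerSeriesAt
  rw [hz] at hfp
  exact hfp.eventually_eq_zero

theorem IsEigenfunction.entire_ode {a b : ℂ} {g G : ℂ → ℂ} (hg : IsEigenfunction a b g)
    (hG : Differentiable ℂ G) (hGg : G =ᶠ[𝓝 0] g) :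
    ∃ ev : ℂ, ∀ z, z ^ 2 * deriv (deriv G) z + (2 * z - a) * deriv G z + b ^ 2 * z ^ 2 * G z
      = ev * G z := by
  obtain ⟨-, -, ev, hev⟩ := hg
  refine ⟨ev, fun z => ?_⟩
  have hG1 : Differentiable ℂ (deriv G) := hG.deriv
  have hG2 : Differentiable ℂ (deriv (deriv G)) := hG1.deriv
  have hL : AnalyticOnNhd ℂ (fun z => z ^ 2 * deriv (deriv G) z + (2 * z - a) * deriv G z
      + b ^ 2 * z ^ 2 * G z) Set.univ :=
    Complex.analyticOnNhd_univ_iff_differentiable.2 (by fun_prop)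
  have hR : AnalyticOnNhd ℂ (fun z => ev * G z) Set.univ :=
    Complex.analyticOnNhd_univ_iff_differentiable.2 (by fun_prop)
  refine congrFun (hL.eq_of_eventuallyEq hR (z₀ := 0) ?_) z
  filter_upwards [hev, hGg, hGg.deriv, hGg.deriv.deriv] with w h1 h2 h3 h4
  rw [h2, h3, h4, ← h1, opL, iteratedDeriv_succ, iteratedDeriv_one]

/-! ### The oscillator form of the equation and the Wronskian identity -/

/-- The equation satisfied by `u(z) = z G(z)` for an entire eigenfunction `G`. -/
structure IsModifiedSolution (a ev : ℂ) (b : ℝ) (u : ℂ → ℂ) : Prop where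
  differentiable : Differentiable ℂ u
  ode : ∀ z, z ^ 3 * (deriv (deriv u) z + (b : ℂ) ^ 2 * u z) = a * z * deriv u z + (ev * z - a) * u z

theorem deriv_id_mul {G : ℂ → ℂ} (hG : Differentiable ℂ G) :
    deriv (fun z => z * G z) = fun z => G z + z * deriv G z := by
  ext z
  have : HasDerivAt (fun z => z * G z) (1 * G z + z * deriv G z) z :=
    (hasDerivAt_id z).mul (hG z).hasDerivAt
  rw [this.deriv, one_mul]

theorem deriv_comp_neg' (u : ℂ → ℂ) : deriv (fun z => u (-z)) = fun z => -deriv u (-z) := by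
  ext z
  exact deriv_comp_neg u z

/-- Multiplication by z absorbs the term 2z G'. What remains is the harmonic oscillator with
perturbing coefficients O(|z|⁻²), which are integrable at infinity. -/
theorem isModifiedSolution_of_entire_ode {a ev : ℂ} {b : ℝ} {G : ℂ → ℂ} (hG : Differentiable ℂ G)
    (h : ∀ z, z ^ 2 * deriv (deriv G) z + (2 * z - a) * deriv G z + (b : ℂ) ^ 2 * z ^ 2 * G z
      = ev * G z) : IsModifiedSolution a ev b (fun z => z * G z) := by
  refine ⟨by fun_prop, fun z => ?_⟩
  have h1 : deriv (deriv fun z => z * G z) z = 2 * deriv G z + z * deriv (deriv G) z := by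
    rw [deriv_id_mul hG]
    have h2 : HasDerivAt (fun z => z * deriv G z) (1 * deriv G z + z * deriv (deriv G) z) z :=
      (hasDerivAt_id z).mul (hG.deriv z).hasDerivAt
    have := (hG z).hasDerivAt.add h2
    rw [show (fun z => G z + z * deriv G z) = G + fun z => z * deriv G z from rfl, this.deriv]
    ring
  rw [h1, deriv_id_mul hG]
  linear_combination z ^ 2 * h z

theorem IsModifiedSolution.comp_neg {a ev : ℂ} {b : ℝ} {u : ℂ → ℂ} (h : IsModifiedSolution a ev b u) :
    IsModifiedSolution (-a) ev b (fun z => u (-z)) := by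
  refine ⟨h.differentiable.comp differentiable_neg, fun z => ?_⟩
  have h1 : deriv (deriv fun z => u (-z)) z = deriv (deriv u) (-z) := by
    rw [deriv_comp_neg' u, deriv.fun_neg]
    simp [deriv_comp_neg' (deriv u)]
  rw [h1, deriv_comp_neg' u]
  linear_combination -h.ode (-z)

/-- The derivative of the left side is -G(-z) times the equation at z plus G(z) times the equation
at -z, hence 0. The constant is the value at 0. -/
theorem wronskian_const {a ev : ℂ} {b : ℝ} {G : ℂ → ℂ} (hG : Differentiable ℂ G)
    (h : ∀ z, z ^ 2 * deriv (deriv G) z + (2 * z - a) * deriv G z + (b : ℂ) ^ 2 * z ^ 2 * G z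
      = ev * G z) (z : ℂ) :
    a * G z * G (-z) - z ^ 2 * (deriv G z * G (-z) + G z * deriv G (-z)) = a * G 0 ^ 2 := by
  set W : ℂ → ℂ := fun z => a * G z * G (-z) - z ^ 2 * (deriv G z * G (-z) + G z * deriv G (-z))
  have hW : ∀ z, HasDerivAt W 0 z := by
    intro z
    have g0 := (hG z).hasDerivAt
    have g1 := (hG.deriv z).hasDerivAt
    have n0 : HasDerivAt (fun z => G (-z)) (deriv G (-z) * -1) z :=
      (hG (-z)).hasDerivAt.comp z (hasDerivAt_neg z)
    have n1 : HasDerivAt (fun z => deriv G (-z)) (deriv (deriv G) (-z) * -1) z :=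
      (hG.deriv (-z)).hasDerivAt.comp z (hasDerivAt_neg z)
    have := ((g0.const_mul a).mul n0).sub (((hasDerivAt_id z).pow 2).mul ((g1.mul n0).add (g0.mul n1)))
    refine this.congr_deriv ?_
    simp
    linear_combination -G (-z) * h z + G z * h (-z)
  have hc := is_const_of_deriv_eq_zero (fun z => (hW z).differentiableAt) (fun z => (hW z).deriv) z 0
  simp only [W] at hc
  rw [hc]
  simp
  ring

theorem wronskian_modified {a ev : ℂ} {b : ℝ} {G : ℂ → ℂ} (hG : Differentiable ℂ G)
    (h : ∀ z, z ^ 2 * deriv (deriv G) z + (2 * z - a) * deriv G z + (b : ℂ) ^ 2 * z ^ 2 * G z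
      = ev * G z) {u : ℂ → ℂ} (hu : u = fun z => z * G z) {z : ℂ} (hz : z ≠ 0) :
    deriv u z * u (-z) + u z * deriv u (-z) - a / z ^ 2 * (u z * u (-z)) = a * G 0 ^ 2 := by
  rw [← wronskian_const hG h z, hu, deriv_id_mul hG]
  field_simp
  ring

/-! ### Energy estimates along rays -/

namespace IsModifiedSolution

variable {a ev : ℂ} {b : ℝ} {u : ℂ → ℂ}

/-- The factorization d² + b² = (d + ib)(d - ib) makes this component constant for the exact
oscillator, so only the defect u'' + b²u drives it. -/
theorem hasDerivAt_incoming (h : IsModifiedSolution a ev b u) (z : ℂ) :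
    HasDerivAt (fun z => (deriv u z - Complex.I * b * u z) * Complex.exp (Complex.I * b * z))
      ((deriv (deriv u) z + (b : ℂ) ^ 2 * u z) * Complex.exp (Complex.I * b * z)) z := by
  have e : HasDerivAt (fun z : ℂ => Complex.exp (Complex.I * b * z))
      (Complex.exp (Complex.I * b * z) * (Complex.I * b * 1)) z :=
    ((hasDerivAt_id z).const_mul (Complex.I * b)).cexp
  refine (((h.differentiable.deriv z).hasDerivAt.sub
    ((h.differentiable z).hasDerivAt.const_mul (Complex.I * b))).mul e).congr_deriv ?_
  simp only [Pi.sub_apply]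
  linear_combination -(Complex.exp (Complex.I * b * z) * b ^ 2 * u z) * Complex.I_sq

/-- Keeping the weight e^{ibz} on the other component leaves the term with factor 2ib, which is
damping along rays in the upper half plane. -/
theorem hasDerivAt_outgoing (h : IsModifiedSolution a ev b u) (z : ℂ) :
    HasDerivAt (fun z => (deriv u z + Complex.I * b * u z) * Complex.exp (Complex.I * b * z))
      ((deriv (deriv u) z + (b : ℂ) ^ 2 * u z) * Complex.exp (Complex.I * b * z)
        + 2 * Complex.I * b
          * ((deriv u z + Complex.I * b * u z) * Complex.exp (Complex.I * b * z))) z := by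
  have e : HasDerivAt (fun z : ℂ => Complex.exp (Complex.I * b * z))
      (Complex.exp (Complex.I * b * z) * (Complex.I * b * 1)) z :=
    ((hasDerivAt_id z).const_mul (Complex.I * b)).cexp
  refine (((h.differentiable.deriv z).hasDerivAt.add
    ((h.differentiable z).hasDerivAt.const_mul (Complex.I * b))).mul e).congr_deriv ?_
  simp only [Pi.add_apply]
  linear_combination -(Complex.exp (Complex.I * b * z) * b ^ 2 * u z) * Complex.I_sq

/-- The defect from the harmonic oscillator equation is `O(|z|⁻²)`. -/
theorem norm_defect_le (h : IsModifiedSolution a ev b u) {z : ℂ} (hz : 1 ≤ ‖z‖) :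
    ‖deriv (deriv u) z + (b : ℂ) ^ 2 * u z‖
      ≤ (‖a‖ * ‖deriv u z‖ + (‖ev‖ + ‖a‖) * ‖u z‖) / ‖z‖ ^ 2 := by
  have hz0 : 0 < ‖z‖ := by linarith
  rw [le_div_iff₀ (by positivity)]
  refine le_of_mul_le_mul_right ?_ hz0
  calc ‖deriv (deriv u) z + (b : ℂ) ^ 2 * u z‖ * ‖z‖ ^ 2 * ‖z‖
      = ‖z ^ 3 * (deriv (deriv u) z + (b : ℂ) ^ 2 * u z)‖ := by
        rw [norm_mul, norm_pow]; ring
    _ = ‖a * z * deriv u z + (ev * z - a) * u z‖ := by rw [h.ode]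
    _ ≤ ‖a‖ * ‖z‖ * ‖deriv u z‖ + (‖ev‖ * ‖z‖ + ‖a‖) * ‖u z‖ := by
        refine (norm_add_le _ _).trans ?_
        rw [norm_mul, norm_mul, norm_mul]
        gcongr
        exact (norm_sub_le _ _).trans (by rw [norm_mul])
    _ ≤ ‖a‖ * ‖z‖ * ‖deriv u z‖ + (‖ev‖ * ‖z‖ + ‖a‖ * ‖z‖) * ‖u z‖ := by
        gcongr
        nlinarith [norm_nonneg a]
    _ = _ := by ring

theorem norm_defect_mul_exp_le (h : IsModifiedSolution a ev b u) (hb : 0 < b) {z : ℂ} (hz : 1 ≤ ‖z‖) :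
    ‖(deriv (deriv u) z + (b : ℂ) ^ 2 * u z) * Complex.exp (Complex.I * b * z)‖
      ≤ (‖a‖ + (‖ev‖ + ‖a‖) / b) / ‖z‖ ^ 2
        * (‖(deriv u z + Complex.I * b * u z) * Complex.exp (Complex.I * b * z)‖
          + ‖(deriv u z - Complex.I * b * u z) * Complex.exp (Complex.I * b * z)‖) := by
  set e := Complex.exp (Complex.I * b * z)
  have h1 : ‖deriv u z‖ ≤ ‖deriv u z + Complex.I * b * u z‖ + ‖deriv u z - Complex.I * b * u z‖ := by
    have : 2 * ‖deriv u z‖ ≤ ‖deriv u z + Complex.I * b * u z‖ + ‖deriv u z - Complex.I * b * u z‖ := by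
      rw [← Complex.norm_two, ← norm_mul]
      refine le_trans (le_of_eq ?_) (norm_add_le _ _)
      congr 1; ring
    linarith [norm_nonneg (deriv u z)]
  have h2 : ‖u z‖ ≤ (‖deriv u z + Complex.I * b * u z‖ + ‖deriv u z - Complex.I * b * u z‖) / b := by
    rw [le_div_iff₀ hb]
    have : 2 * (‖u z‖ * b) ≤ ‖deriv u z + Complex.I * b * u z‖ + ‖deriv u z - Complex.I * b * u z‖ := by
      refine le_trans (le_of_eq ?_) (norm_sub_le _ _)
      rw [show deriv u z + Complex.I * b * u z - (deriv u z - Complex.I * b * u z)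
        = 2 * (Complex.I * b * u z) by ring]
      simp [abs_of_pos hb, mul_comm]
    nlinarith [norm_nonneg (u z)]
  rw [norm_mul, norm_mul, norm_mul, ← add_mul, ← mul_assoc]
  gcongr
  refine (h.norm_defect_le hz).trans ?_
  rw [div_mul_eq_mul_div]
  gcongr
  set X := ‖deriv u z + Complex.I * b * u z‖ + ‖deriv u z - Complex.I * b * u z‖
  calc ‖a‖ * ‖deriv u z‖ + (‖ev‖ + ‖a‖) * ‖u z‖ ≤ ‖a‖ * X + (‖ev‖ + ‖a‖) * (X / b) := by gcongr
    _ = _ := by ring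

/-- Along every ray in the upper half plane the energy is controlled by its value on the unit
circle. -/
theorem energy_le (h : IsModifiedSolution a ev b u) (hb : 0 < b) {w : ℂ} (hw : ‖w‖ = 1)
    (hw0 : 0 ≤ w.im) {t : ℝ} (ht : 1 ≤ t) :
    ‖(deriv u (t * w) + Complex.I * b * u (t * w)) * Complex.exp (Complex.I * b * (t * w))‖ ^ 2
      + ‖(deriv u (t * w) - Complex.I * b * u (t * w)) * Complex.exp (Complex.I * b * (t * w))‖ ^ 2
    ≤ (‖(deriv u w + Complex.I * b * u w) * Complex.exp (Complex.I * b * w)‖ ^ 2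
      + ‖(deriv u w - Complex.I * b * u w) * Complex.exp (Complex.I * b * w)‖ ^ 2)
      * Real.exp (4 * (‖a‖ + (‖ev‖ + ‖a‖) / b)) := by
  set K := ‖a‖ + (‖ev‖ + ‖a‖) / b with hK
  have hK0 : 0 ≤ K := by positivity
  set P : ℂ → ℂ := fun z => (deriv u z + Complex.I * b * u z) * Complex.exp (Complex.I * b * z)
  set Q : ℂ → ℂ := fun z => (deriv u z - Complex.I * b * u z) * Complex.exp (Complex.I * b * z)
  set D : ℂ → ℂ := fun z => (deriv (deriv u) z + (b : ℂ) ^ 2 * u z) * Complex.exp (Complex.I * b * z)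
  have hline : ∀ s : ℝ, HasDerivAt (fun s : ℝ => (s : ℂ) * w) w s := fun s => by
    simpa using (Complex.ofRealCLM.hasDerivAt (x := s)).mul_const w
  have hP : ∀ s : ℝ, HasDerivAt (fun s : ℝ => P (s * w))
      ((D (s * w) + 2 * Complex.I * b * P (s * w)) * w) s := fun s =>
    HasDerivAt.comp (h₂ := P) s (h.hasDerivAt_outgoing (s * w)) (hline s)
  have hQ : ∀ s : ℝ, HasDerivAt (fun s : ℝ => Q (s * w)) (D (s * w) * w) s := fun s =>
    HasDerivAt.comp (h₂ := Q) s (h.hasDerivAt_incoming (s * w)) (hline s)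
  -- The energy grows at a logarithmic rate of at most 4K/s². The weight exp(4K/s) has logarithmic
  -- derivative -4K/s², so E is nonincreasing.
  set E : ℝ → ℝ := fun s => (‖P (s * w)‖ ^ 2 + ‖Q (s * w)‖ ^ 2) * Real.exp (4 * K / s)
  have hE : ∀ s : ℝ, 0 < s → HasDerivAt E
      ((2 * inner ℝ (P (s * w)) ((D (s * w) + 2 * Complex.I * b * P (s * w)) * w)
        + 2 * inner ℝ (Q (s * w)) (D (s * w) * w)) * Real.exp (4 * K / s)
      + (‖P (s * w)‖ ^ 2 + ‖Q (s * w)‖ ^ 2) * (Real.exp (4 * K / s) * (-(4 * K) / s ^ 2))) s := by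
    intro s hs
    have he : HasDerivAt (fun s : ℝ => 4 * K / s) (-(4 * K) / s ^ 2) s := by
      refine ((hasDerivAt_inv hs.ne').const_mul (4 * K)).congr_deriv ?_
      ring
    exact (((hP s).norm_sq.add (hQ s).norm_sq).mul he.exp)
  have hanti : AntitoneOn E (Set.Ici 1) := by
    refine antitoneOn_of_deriv_nonpos (convex_Ici 1) (fun s hs =>
      (hE s (by linarith [Set.mem_Ici.1 hs])).continuousAt.continuousWithinAt) (fun s hs => ?_) fun s hs => ?_
    · rw [interior_Ici] at hs
      exact (hE s (by linarith [Set.mem_Ioi.1 hs])).differentiableAt.differentiableWithinAt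
    · rw [interior_Ici] at hs
      have hs1 : 1 < s := hs
      have hs0 : 0 < s := by linarith
      rw [(hE s hs0).deriv]
      have hnorm : ‖(s : ℂ) * w‖ = s := by
        rw [norm_mul, hw, mul_one, Complex.norm_of_nonneg hs0.le]
      have hD := h.norm_defect_mul_exp_le hb (z := s * w) (by rw [hnorm]; exact hs1.le)
      rw [hnorm] at hD
      change ‖D (s * w)‖ ≤ K / s ^ 2 * (‖P (s * w)‖ + ‖Q (s * w)‖) at hD
      have i1 : inner ℝ (P (s * w)) ((D (s * w) + 2 * Complex.I * b * P (s * w)) * w)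
          ≤ ‖P (s * w)‖ * ‖D (s * w)‖ := by
        rw [add_mul, inner_add_right]
        have j1 : inner ℝ (P (s * w)) (D (s * w) * w) ≤ ‖P (s * w)‖ * ‖D (s * w)‖ := by
          refine (real_inner_le_norm _ _).trans ?_
          rw [norm_mul (D _), hw, mul_one]
        -- Damping: the real part of 2ibw is -2b Im w ≤ 0.
        have j2 : inner ℝ (P (s * w)) (2 * Complex.I * b * P (s * w) * w) ≤ 0 := by
          have : inner ℝ (P (s * w)) (2 * Complex.I * b * P (s * w) * w)
              = -(2 * b * w.im * ‖P (s * w)‖ ^ 2) := by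
            rw [Complex.inner, ← Complex.normSq_eq_norm_sq, Complex.normSq_apply]
            simp
            ring
          rw [this, neg_nonpos]
          positivity
        linarith
      have i2 : inner ℝ (Q (s * w)) (D (s * w) * w) ≤ ‖Q (s * w)‖ * ‖D (s * w)‖ := by
        refine (real_inner_le_norm _ _).trans ?_
        rw [norm_mul (D _), hw, mul_one]
      have i3 : 2 * inner ℝ (P (s * w)) ((D (s * w) + 2 * Complex.I * b * P (s * w)) * w)
          + 2 * inner ℝ (Q (s * w)) (D (s * w) * w)
          ≤ (‖P (s * w)‖ ^ 2 + ‖Q (s * w)‖ ^ 2) * (4 * K / s ^ 2) := by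
        have i4 : (‖P (s * w)‖ + ‖Q (s * w)‖) * ‖D (s * w)‖
            ≤ (‖P (s * w)‖ + ‖Q (s * w)‖) * (K / s ^ 2 * (‖P (s * w)‖ + ‖Q (s * w)‖)) := by gcongr
        have i5 : (‖P (s * w)‖ + ‖Q (s * w)‖) ^ 2 * (K / s ^ 2)
            ≤ (2 * (‖P (s * w)‖ ^ 2 + ‖Q (s * w)‖ ^ 2)) * (K / s ^ 2) := by
          gcongr
          nlinarith [sq_nonneg (‖P (s * w)‖ - ‖Q (s * w)‖)]
        calc _ ≤ 2 * ((‖P (s * w)‖ + ‖Q (s * w)‖) * ‖D (s * w)‖) := by linarith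
          _ ≤ 2 * ((‖P (s * w)‖ + ‖Q (s * w)‖) ^ 2 * (K / s ^ 2)) := by linarith
          _ ≤ 2 * ((2 * (‖P (s * w)‖ ^ 2 + ‖Q (s * w)‖ ^ 2)) * (K / s ^ 2)) := by linarith
          _ = _ := by ring
      have := mul_le_mul_of_nonneg_right i3 (Real.exp_pos (4 * K / s)).le
      calc _ ≤ (‖P (s * w)‖ ^ 2 + ‖Q (s * w)‖ ^ 2) * (4 * K / s ^ 2) * Real.exp (4 * K / s)
          + (‖P (s * w)‖ ^ 2 + ‖Q (s * w)‖ ^ 2) * (Real.exp (4 * K / s) * (-(4 * K) / s ^ 2)) := by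
            linarith
        _ = 0 := by ring
  have h1 := hanti (Set.mem_Ici.2 le_rfl) (Set.mem_Ici.2 ht) ht
  simp only [E, Complex.ofReal_one, one_mul, div_one] at h1
  refine le_trans ?_ h1
  refine le_mul_of_one_le_right (by positivity) (Real.one_le_exp (by positivity))

theorem exists_energy_bound (h : IsModifiedSolution a ev b u) (hb : 0 < b) :
    ∃ C, ∀ z : ℂ, 0 ≤ z.im →
      ‖(deriv u z + Complex.I * b * u z) * Complex.exp (Complex.I * b * z)‖ ≤ C ∧
      ‖(deriv u z - Complex.I * b * u z) * Complex.exp (Complex.I * b * z)‖ ≤ C := by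
  have hu := h.differentiable
  have hu' := hu.deriv
  have hc : Continuous fun z : ℂ =>
      ‖(deriv u z + Complex.I * b * u z) * Complex.exp (Complex.I * b * z)‖ ^ 2
      + ‖(deriv u z - Complex.I * b * u z) * Complex.exp (Complex.I * b * z)‖ ^ 2 := by
    have := hu.continuous
    have := hu'.continuous
    fun_prop
  obtain ⟨M, hM⟩ := (isCompact_closedBall (0 : ℂ) 1).exists_bound_of_continuousOn hc.continuousOn
  set X := Real.exp (4 * (‖a‖ + (‖ev‖ + ‖a‖) / b))
  have hX : 1 ≤ X := Real.one_le_exp (by positivity)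
  have hM0 : 0 ≤ M := (norm_nonneg _).trans (hM 0 (by simp))
  have key : ∀ z : ℂ, 0 ≤ z.im →
      ‖(deriv u z + Complex.I * b * u z) * Complex.exp (Complex.I * b * z)‖ ^ 2
      + ‖(deriv u z - Complex.I * b * u z) * Complex.exp (Complex.I * b * z)‖ ^ 2 ≤ M * X := by
    intro z hz
    rcases le_total ‖z‖ 1 with h1 | h1
    · have := (le_abs_self _).trans (hM z (by simpa using h1))
      nlinarith
    · have hz0 : z ≠ 0 := by rintro rfl; simp at h1; linarith
      have hn : (‖z‖ : ℂ) ≠ 0 := by simpa using hz0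
      have hw : ‖z / ‖z‖‖ = 1 := by simp [hz0]
      have hwi : 0 ≤ (z / ‖z‖).im := by
        rw [Complex.div_ofReal_im]; positivity
      have := h.energy_le hb hw hwi h1
      rw [mul_div_cancel₀ z hn] at this
      refine this.trans ?_
      gcongr
      exact (le_abs_self _).trans (hM _ (mem_closedBall_zero_iff.2 hw.le))
  refine ⟨Real.sqrt (M * X), fun z hz => ⟨Real.le_sqrt_of_sq_le ?_, Real.le_sqrt_of_sq_le ?_⟩⟩
  · exact (le_add_of_nonneg_right (by positivity)).trans (key z hz)
  · exact (le_add_of_nonneg_left (by positivity)).trans (key z hz)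

end IsModifiedSolution

/-! ### Growth bounds and amplitudes at infinity -/

theorem norm_exp_I_mul_mul (b : ℝ) (z : ℂ) : ‖Complex.exp (Complex.I * b * z)‖ = Real.exp (-(b * z.im)) := by
  rw [Complex.norm_exp]; simp

namespace IsModifiedSolution

variable {a ev : ℂ} {b : ℝ} {u : ℂ → ℂ}

theorem exists_upper_bound_of_im_nonneg (h : IsModifiedSolution a ev b u) (hb : 0 < b) :
    ∃ C, 0 ≤ C ∧ ∀ z : ℂ, 0 ≤ z.im →
      ‖u z‖ ≤ C * Real.exp (b * |z.im|) ∧ ‖deriv u z‖ ≤ C * Real.exp (b * |z.im|) := by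
  obtain ⟨C, hC⟩ := h.exists_energy_bound hb
  have hC0 : 0 ≤ C := (norm_nonneg _).trans (hC 0 le_rfl).1
  refine ⟨C + C / b, by positivity, fun z hz => ?_⟩
  obtain ⟨h1, h2⟩ := hC z hz
  rw [norm_mul, norm_exp_I_mul_mul, Real.exp_neg, ← div_eq_mul_inv, div_le_iff₀ (Real.exp_pos _)] at h1 h2
  rw [abs_of_nonneg hz]
  set X := Real.exp (b * z.im)
  have hX : 0 < X := Real.exp_pos _
  constructor
  · have h3 : 2 * b * ‖u z‖ ≤ 2 * (C * X) := by
      have : 2 * b * ‖u z‖ = ‖(deriv u z + Complex.I * b * u z) - (deriv u z - Complex.I * b * u z)‖ := by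
        rw [show deriv u z + Complex.I * b * u z - (deriv u z - Complex.I * b * u z)
          = 2 * (Complex.I * b * u z) by ring]
        simp [abs_of_pos hb, mul_assoc]
      rw [this]
      exact (norm_sub_le _ _).trans (by linarith)
    have h4 : ‖u z‖ ≤ C / b * X := by
      rw [div_mul_eq_mul_div, le_div_iff₀ hb]; linarith
    nlinarith [mul_nonneg hC0 hX.le]
  · have h3 : 2 * ‖deriv u z‖ ≤ 2 * (C * X) := by
      have : 2 * ‖deriv u z‖ = ‖(deriv u z + Complex.I * b * u z) + (deriv u z - Complex.I * b * u z)‖ := by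
        rw [show deriv u z + Complex.I * b * u z + (deriv u z - Complex.I * b * u z)
          = 2 * deriv u z by ring]
        simp
      rw [this]
      exact (norm_add_le _ _).trans (by linarith)
    have : 0 ≤ C / b * X := by positivity
    nlinarith

theorem exists_upper_bound (h : IsModifiedSolution a ev b u) (hb : 0 < b) :
    ∃ C, 0 ≤ C ∧ ∀ z : ℂ,
      ‖u z‖ ≤ C * Real.exp (b * |z.im|) ∧ ‖deriv u z‖ ≤ C * Real.exp (b * |z.im|) := by
  obtain ⟨C₁, h1, hC₁⟩ := h.exists_upper_bound_of_im_nonneg hb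
  obtain ⟨C₂, h2, hC₂⟩ := h.comp_neg.exists_upper_bound_of_im_nonneg hb
  refine ⟨C₁ + C₂, by positivity, fun z => ?_⟩
  have hX : 0 < Real.exp (b * |z.im|) := Real.exp_pos _
  rcases le_total 0 z.im with hz | hz
  · obtain ⟨h3, h4⟩ := hC₁ z hz
    constructor <;> nlinarith
  · obtain ⟨h3, h4⟩ := hC₂ (-z) (by simpa using hz)
    rw [deriv_comp_neg' u] at h4
    simp only [neg_neg, Complex.neg_im, abs_neg, norm_neg] at h3 h4
    constructor <;> nlinarith

/-- In the upper half plane the incoming amplitude converges at infinity, with rate `O(|z|⁻¹)`. -/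
theorem exists_incoming_limit (h : IsModifiedSolution a ev b u) (hb : 0 < b) :
    ∃ (q : ℂ) (C : ℝ), 0 ≤ C ∧ ∀ z : ℂ, 0 ≤ z.im →
      ‖(deriv u z - Complex.I * b * u z) * Complex.exp (Complex.I * b * z) - q‖ * ‖z‖ ≤ C := by
  obtain ⟨M, hM⟩ := h.exists_energy_bound hb
  have hM0 : 0 ≤ M := (norm_nonneg _).trans (hM 0 le_rfl).1
  set K := ‖a‖ + (‖ev‖ + ‖a‖) / b with hK
  have hK0 : 0 ≤ K := by positivity
  set Q : ℂ → ℂ := fun z => (deriv u z - Complex.I * b * u z) * Complex.exp (Complex.I * b * z) with hQ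
  have hQd : ∀ z, HasDerivAt Q _ z := h.hasDerivAt_incoming
  have hQc : Continuous Q := continuous_iff_continuousAt.2 fun z => (hQd z).continuousAt
  -- Under z = 1/w, the part of the open upper half plane outside the unit disc becomes this half
  -- disc, which is convex. The O(|z|⁻²) derivative of Q cancels against the Jacobian w⁻², so w ↦
  -- Q(1/w) is Lipschitz there.
  set s : Set ℂ := {w | w.im < 0} ∩ Metric.ball 0 1 with hs
  have hconv : Convex ℝ s := (convex_halfSpace_im_lt 0).inter (convex_ball 0 1)
  have hlip : LipschitzOnWith (Real.toNNReal (K * (2 * M))) (fun w => Q w⁻¹) s := by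
    have hne : ∀ w ∈ s, w ≠ 0 := by
      rintro w hw rfl
      simpa using hw.1
    refine hconv.lipschitzOnWith_of_nnnorm_hasDerivWithin_le
      (fun w hw => (HasDerivAt.comp (h₂ := Q) w (hQd w⁻¹) (hasDerivAt_inv (hne w hw))).hasDerivWithinAt)
      fun w hw => ?_
    rw [← NNReal.coe_le_coe, coe_nnnorm, Real.coe_toNNReal _ (by positivity)]
    have hw1 : 1 ≤ ‖w⁻¹‖ := by
      rw [norm_inv]
      exact (one_le_inv₀ (norm_pos_iff.2 (hne w hw))).2 (mem_ball_zero_iff.1 hw.2).le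
    have hwi : 0 ≤ (w⁻¹).im := by
      rw [Complex.inv_im]
      have : w.im < 0 := hw.1
      exact div_nonneg (by linarith) (Complex.normSq_nonneg _)
    have h1 := h.norm_defect_mul_exp_le hb hw1
    obtain ⟨h2, h3⟩ := hM _ hwi
    have hwn : 0 < ‖w‖ := norm_pos_iff.2 (hne w hw)
    rw [norm_mul, norm_neg, norm_inv, norm_pow]
    rw [← div_eq_mul_inv, div_le_iff₀ (by positivity)]
    refine h1.trans ?_
    rw [norm_inv, inv_pow, div_inv_eq_mul]
    calc _ ≤ K * ‖w‖ ^ 2 * (M + M) := by gcongr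
      _ = _ := by ring
  -- The value at w = 0 of a Lipschitz extension is the limit of Q at infinity, and the Lipschitz
  -- bound between w and 0 is the rate O(1/|z|). Real z are reached below by letting ε → 0 in z +
  -- iε.
  obtain ⟨g, hg, hgs⟩ := hlip.extend_finite_dimension
  set C₁ : ℝ := ((lipschitzExtensionConstant ℂ * Real.toNNReal (K * (2 * M)) : NNReal) : ℝ) with hC₁
  have hC₁0 : 0 ≤ C₁ := NNReal.coe_nonneg _
  have hopen : ∀ z : ℂ, 0 < z.im → 1 < ‖z‖ → ‖Q z - g 0‖ * ‖z‖ ≤ C₁ := by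
    intro z hz hz1
    have hz0 : 0 < ‖z‖ := by linarith
    have hzs : z⁻¹ ∈ s := by
      refine ⟨?_, ?_⟩
      · change (z⁻¹).im < 0
        rw [Complex.inv_im]
        exact div_neg_of_neg_of_pos (by linarith) (Complex.normSq_pos.2 (norm_pos_iff.1 hz0))
      · rw [mem_ball_zero_iff, norm_inv]
        exact inv_lt_one_of_one_lt₀ hz1
    have h1 := hg.dist_le_mul z⁻¹ 0
    rw [← hgs hzs] at h1
    beta_reduce at h1
    rw [inv_inv, dist_eq_norm, dist_zero_right, norm_inv, ← div_eq_mul_inv,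
      le_div_iff₀ hz0] at h1
    exact h1
  refine ⟨g 0, C₁ + (M + ‖g 0‖), by positivity, fun z hz => ?_⟩
  rcases lt_or_ge 1 ‖z‖ with hz1 | hz1
  · have hlim : Tendsto (fun ε : ℝ => ‖Q (z + ε * Complex.I) - g 0‖ * ‖z + ε * Complex.I‖) (𝓝[>] 0)
        (𝓝 (‖Q z - g 0‖ * ‖z‖)) := by
      refine Tendsto.mono_left ?_ nhdsWithin_le_nhds
      exact Continuous.tendsto' (by fun_prop) _ _ (by simp)
    have : ‖Q z - g 0‖ * ‖z‖ ≤ C₁ := by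
      refine le_of_tendsto hlim ?_
      have hcl : ∀ᶠ ε : ℝ in 𝓝[>] 0, 1 < ‖z + ε * Complex.I‖ := by
        refine (Tendsto.mono_left ?_ nhdsWithin_le_nhds).eventually (lt_mem_nhds hz1)
        exact Continuous.tendsto' (by fun_prop) _ _ (by simp)
      filter_upwards [hcl, self_mem_nhdsWithin] with ε h1 h2
      exact hopen _ (by simpa using add_pos_of_nonneg_of_pos hz h2) h1
    linarith [norm_nonneg (g 0)]
  · have h1 : ‖Q z - g 0‖ ≤ M + ‖g 0‖ := (norm_sub_le _ _).trans (by linarith [(hM z hz).2])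
    nlinarith [norm_nonneg (Q z - g 0), norm_nonneg z, norm_nonneg (g 0)]

/-- Leading asymptotics deep in the upper half plane. -/
theorem exists_asymptotics_upper (h : IsModifiedSolution a ev b u) (hb : 0 < b) {q : ℂ} {C : ℝ}
    (hC : ∀ z : ℂ, 0 ≤ z.im →
      ‖(deriv u z - Complex.I * b * u z) * Complex.exp (Complex.I * b * z) - q‖ * ‖z‖ ≤ C) :
    ∃ C', 0 ≤ C' ∧ ∀ z : ℂ, 0 < z.im →
      ‖2 * Complex.I * b * u z * Complex.exp (Complex.I * b * z) + q‖ * z.im ≤ C' := by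
  obtain ⟨M, hM0, hM⟩ := h.exists_upper_bound hb
  set D : ℂ → ℂ := fun z => 2 * Complex.I * b * u z * Complex.exp (Complex.I * b * z) + q with hD
  -- With ε the error of the incoming amplitude, D' = 2ib(D + ε). Cauchy's estimate on the disc of
  -- radius Im z, where D is bounded, gives D' = O(1/Im z), so D is as small as D' and ε.
  have hDd : ∀ z, HasDerivAt D (2 * Complex.I * b * D z
      + 2 * Complex.I * b * ((deriv u z - Complex.I * b * u z) * Complex.exp (Complex.I * b * z) - q)) z := by
    intro z
    have e : HasDerivAt (fun z : ℂ => Complex.exp (Complex.I * b * z))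
        (Complex.exp (Complex.I * b * z) * (Complex.I * b * 1)) z :=
      ((hasDerivAt_id z).const_mul (Complex.I * b)).cexp
    refine ((((h.differentiable z).hasDerivAt.const_mul (2 * Complex.I * b)).mul e).add_const q).congr_deriv ?_
    simp only [D]
    ring
  have hDM : ∀ z : ℂ, 0 ≤ z.im → ‖D z‖ ≤ 2 * b * M + ‖q‖ := by
    intro z hz
    refine (norm_add_le _ _).trans ?_
    gcongr
    rw [norm_mul, norm_mul, norm_exp_I_mul_mul]
    have h1 := (hM z).1
    rw [abs_of_nonneg hz] at h1
    have h2 : ‖2 * Complex.I * (b : ℂ)‖ = 2 * b := by simp [abs_of_pos hb]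
    rw [h2, mul_assoc]
    gcongr
    rwa [Real.exp_neg, ← div_eq_mul_inv, div_le_iff₀ (Real.exp_pos _)]
  have hC0 : 0 ≤ C := (by positivity : (0:ℝ) ≤ _).trans (hC 0 le_rfl)
  refine ⟨(2 * b * M + ‖q‖ + 2 * b * C) / (2 * b), by positivity, fun z hz => ?_⟩
  have h1 : ‖deriv D z‖ ≤ (2 * b * M + ‖q‖) / z.im := by
    refine Complex.norm_deriv_le_of_forall_mem_sphere_norm_le hz
      (Differentiable.diffContOnCl fun z => (hDd z).differentiableAt) fun w hw => hDM w ?_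
    have h3 := Complex.abs_im_le_norm (w - z)
    rw [mem_sphere_iff_norm.1 hw, Complex.sub_im] at h3
    linarith [(abs_le.1 h3).1]
  rw [(hDd z).deriv] at h1
  set ε := (deriv u z - Complex.I * b * u z) * Complex.exp (Complex.I * b * z) - q with hε
  have h2 : ‖ε‖ * z.im ≤ C := by
    refine le_trans ?_ (hC z hz.le)
    gcongr
    exact (le_abs_self _).trans (Complex.abs_im_le_norm z)
  have hn : ∀ w : ℂ, ‖2 * Complex.I * b * w‖ = 2 * b * ‖w‖ := fun w => by
    simp [abs_of_pos hb]
  have h3 : 2 * b * ‖D z‖ ≤ (2 * b * M + ‖q‖) / z.im + 2 * b * ‖ε‖ := by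
    rw [← hn, ← hn]
    calc ‖2 * Complex.I * b * D z‖
        = ‖(2 * Complex.I * b * D z + 2 * Complex.I * b * ε) - 2 * Complex.I * b * ε‖ := by
          rw [add_sub_cancel_right]
      _ ≤ _ := (norm_sub_le _ _).trans (by linarith)
  rw [le_div_iff₀ (by positivity)]
  have h4 : (2 * b * M + ‖q‖) / z.im * z.im = 2 * b * M + ‖q‖ := div_mul_cancel₀ _ hz.ne'
  nlinarith [mul_le_mul_of_nonneg_right h3 hz.le]

end IsModifiedSolution

/-- Phragmén–Lindelöf in the upper half plane for functions of finite exponential type that are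
bounded on the positive imaginary axis. -/
theorem norm_le_of_bounded_on_real_of_bounded_on_imag {F : ℂ → ℂ} (hF : Differentiable ℂ F) {A B M M' : ℝ}
    (hAB : ∀ z, ‖F z‖ ≤ A * Real.exp (B * ‖z‖)) (hre : ∀ x : ℝ, ‖F x‖ ≤ M)
    (him : ∀ y : ℝ, 0 ≤ y → ‖F (Complex.I * y)‖ ≤ M') {z : ℂ} (hz : 0 ≤ z.im) : ‖F z‖ ≤ M := by
  have := PhragmenLindelof.right_half_plane_of_bounded_on_real (f := fun w => F (Complex.I * w))
    (C := M) (z := -Complex.I * z) (Differentiable.diffContOnCl (by fun_prop)) ?_ ?_ ?_ (by simpa using hz)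
  · rwa [show Complex.I * (-Complex.I * z) = z by linear_combination (-z) * Complex.I_sq] at this
  · refine ⟨1, by norm_num, B, Asymptotics.IsBigO.of_bound A (Eventually.of_forall fun w => ?_)⟩
    refine (hAB _).trans ?_
    simp
  · exact isBoundedUnder_of_eventually_le (a := M') (by
      filter_upwards [eventually_ge_atTop 0] with y hy using him y hy)
  · intro x
    have := hre (-x)
    rwa [show Complex.I * (x * Complex.I) = ((-x : ℝ) : ℂ) by
      push_cast; linear_combination (x : ℂ) * Complex.I_sq]

/-- `p` and `q` are the amplitudes at infinity of the oscillating components `e^{± i b z}` of `u`. -/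
structure HasAmplitudes (b : ℝ) (u : ℂ → ℂ) (p q : ℂ) (C : ℝ) : Prop where
  nonneg : 0 ≤ C
  upper : ∀ z : ℂ, 0 < z.im →
    ‖2 * Complex.I * b * u z * Complex.exp (Complex.I * b * z) + q‖ * z.im ≤ C
  lower : ∀ z : ℂ, z.im < 0 →
    ‖2 * Complex.I * b * u z * Complex.exp (-(Complex.I * b * z)) - p‖ * -z.im ≤ C
  incoming : ∀ z : ℂ, 0 ≤ z.im →
    ‖(deriv u z - Complex.I * b * u z) * Complex.exp (Complex.I * b * z) - q‖ * ‖z‖ ≤ C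
  outgoing : ∀ z : ℂ, z.im ≤ 0 →
    ‖(deriv u z + Complex.I * b * u z) * Complex.exp (-(Complex.I * b * z)) - p‖ * ‖z‖ ≤ C

theorem HasAmplitudes.comp_neg {b : ℝ} {u : ℂ → ℂ} {p q : ℂ} {C : ℝ} (h : HasAmplitudes b u p q C) :
    HasAmplitudes b (fun z => u (-z)) (-q) (-p) C where
  nonneg := h.nonneg
  upper z hz := by simpa [sub_eq_add_neg] using h.lower (-z) (by simpa using hz)
  lower z hz := by simpa [sub_eq_add_neg] using h.upper (-z) (by simpa using hz)
  incoming z hz := by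
    refine le_trans (le_of_eq ?_) (h.outgoing (-z) (by simpa using hz))
    rw [deriv_comp_neg' u, ← norm_neg (_ - p), norm_neg z]
    congr 2
    simp only [mul_neg, neg_neg]
    ring
  outgoing z hz := by
    refine le_trans (le_of_eq ?_) (h.incoming (-z) (by simpa using hz))
    rw [deriv_comp_neg' u, ← norm_neg (_ - q), norm_neg z]
    congr 2
    simp only [mul_neg]
    ring

namespace IsModifiedSolution

variable {a ev : ℂ} {b : ℝ} {u : ℂ → ℂ}

theorem exists_hasAmplitudes (h : IsModifiedSolution a ev b u) (hb : 0 < b) :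
    ∃ p q C, HasAmplitudes b u p q C := by
  obtain ⟨q, C₁, h1, hq⟩ := h.exists_incoming_limit hb
  obtain ⟨C₂, h2, hU⟩ := h.exists_asymptotics_upper hb hq
  obtain ⟨p, C₃, h3, hp⟩ := h.comp_neg.exists_incoming_limit hb
  obtain ⟨C₄, h4, hL⟩ := h.comp_neg.exists_asymptotics_upper hb hp
  refine ⟨-p, q, C₁ + C₂ + C₃ + C₄, by positivity, fun z hz => (hU z hz).trans (by linarith),
    fun z hz => ?_, fun z hz => (hq z hz).trans (by linarith), fun z hz => ?_⟩
  · have := hL (-z) (by simpa using hz)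
    simp only [neg_neg, mul_neg, Complex.neg_im] at this
    rw [sub_neg_eq_add, mul_neg]
    linarith
  · refine le_trans (le_of_eq ?_) ((hp (-z) (by simpa using hz)).trans (by linarith))
    rw [deriv_comp_neg' u, ← norm_neg (_ - p), norm_neg z]
    congr 2
    simp only [mul_neg, neg_neg]
    ring

/-- For P = u' + ibu and Q = u' - ibu one has P(x)P(-x) - Q(x)Q(-x) = 2ib(u'(x)u(-x) + u(x)u'(-x)),
and the exponential weights at x and -x cancel. As x → ∞ along the positive integers, the left side
tends to p² - q² and the term with a/x² disappears. -/
theorem amplitude_wronskian (h : IsModifiedSolution a ev b u) (hb : 0 < b) {p q : ℂ} {C : ℝ}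
    (hA : HasAmplitudes b u p q C) {w : ℂ}
    (hw : ∀ z ≠ 0, deriv u z * u (-z) + u z * deriv u (-z) - a / z ^ 2 * (u z * u (-z)) = w) :
    p ^ 2 - q ^ 2 = 2 * Complex.I * b * w := by
  obtain ⟨M, hM0, hM⟩ := h.exists_upper_bound hb
  have hC : Tendsto (fun n : ℕ => C / ((n : ℝ) + 1)) atTop (𝓝 0) := by
    simpa [div_eq_mul_inv] using tendsto_one_div_add_atTop_nhds_zero_nat.const_mul C
  have hx : ∀ n : ℕ, ‖((n : ℂ) + 1)‖ = (n : ℝ) + 1 := fun n => by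
    rw [show (n : ℂ) + 1 = (((n : ℝ) + 1 : ℝ) : ℂ) by push_cast; ring,
      Complex.norm_of_nonneg (by positivity)]
  have lim : ∀ (f : ℂ → ℂ) (l : ℂ) (σ : ℂ), ‖σ‖ = 1 → σ.im = 0 →
      (∀ z : ℂ, z.im = 0 → ‖f z - l‖ * ‖z‖ ≤ C) →
      Tendsto (fun n : ℕ => f (σ * (n + 1))) atTop (𝓝 l) := by
    intro f l σ hσ hσi hf
    rw [tendsto_iff_norm_sub_tendsto_zero]
    refine squeeze_zero (fun _ => norm_nonneg _) (fun n => ?_) hC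
    rw [le_div_iff₀ (by positivity), ← hx n, ← one_mul ‖(n : ℂ) + 1‖, ← hσ, ← norm_mul]
    exact hf _ (by simp [hσi])
  have q1 := lim _ _ 1 (by simp) (by simp) fun z hz => hA.incoming z hz.ge
  have q2 := lim _ _ (-1) (by simp) (by simp) fun z hz => hA.incoming z hz.ge
  have p1 := lim _ _ 1 (by simp) (by simp) fun z hz => hA.outgoing z hz.le
  have p2 := lim _ _ (-1) (by simp) (by simp) fun z hz => hA.outgoing z hz.le
  have hlim := (p1.mul p2).sub (q1.mul q2)
  have hu0 : Tendsto (fun n : ℕ => a / ((n : ℂ) + 1) ^ 2 * (u (n + 1) * u (-(n + 1)))) atTop (𝓝 0) := by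
    rw [tendsto_zero_iff_norm_tendsto_zero]
    have h2 : Tendsto (fun n : ℕ => (‖a‖ * M ^ 2) * (1 / ((n : ℝ) + 1))) atTop (𝓝 0) := by
      simpa using tendsto_one_div_add_atTop_nhds_zero_nat.const_mul (‖a‖ * M ^ 2)
    refine squeeze_zero (fun _ => norm_nonneg _) (fun n => ?_) h2
    rw [norm_mul, norm_div, norm_pow, hx, norm_mul]
    have b1 : ‖u (n + 1)‖ ≤ M := by simpa using (hM (n + 1)).1
    have b2 : ‖u (-(n + 1))‖ ≤ M := by simpa using (hM (-(n + 1))).1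
    have hn : (1 : ℝ) ≤ n + 1 := by linarith [n.cast_nonneg (α := ℝ)]
    calc ‖a‖ / ((n : ℝ) + 1) ^ 2 * (‖u (n + 1)‖ * ‖u (-(n + 1))‖)
        ≤ ‖a‖ / ((n : ℝ) + 1) * (M * M) := by
          gcongr
          exact le_self_pow₀ hn two_ne_zero
      _ = _ := by ring
  have hlim2 := ((hu0.const_add w).const_mul (2 * Complex.I * b))
  have heq : ∀ n : ℕ, 2 * Complex.I * b * (w + a / ((n : ℂ) + 1) ^ 2 * (u (n + 1) * u (-(n + 1))))
      = (deriv u (1 * (n + 1)) + Complex.I * b * u (1 * (n + 1))) * Complex.exp (-(Complex.I * b * (1 * (n + 1))))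
        * ((deriv u (-1 * (n + 1)) + Complex.I * b * u (-1 * (n + 1)))
          * Complex.exp (-(Complex.I * b * (-1 * (n + 1)))))
      - (deriv u (1 * (n + 1)) - Complex.I * b * u (1 * (n + 1))) * Complex.exp (Complex.I * b * (1 * (n + 1)))
        * ((deriv u (-1 * (n + 1)) - Complex.I * b * u (-1 * (n + 1)))
          * Complex.exp (Complex.I * b * (-1 * (n + 1)))) := by
    intro n
    have hn : (n : ℂ) + 1 ≠ 0 := by exact_mod_cast n.succ_ne_zero
    have h1 := hw _ hn
    simp only [one_mul, neg_mul, mul_neg, neg_neg]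
    have he : Complex.exp (-(Complex.I * b * ((n : ℂ) + 1))) * Complex.exp (Complex.I * b * ((n : ℂ) + 1)) = 1 := by
      rw [← Complex.exp_add]; simp
    rw [← h1]
    set e := Complex.exp (Complex.I * b * ((n : ℂ) + 1))
    set e' := Complex.exp (-(Complex.I * b * ((n : ℂ) + 1)))
    linear_combination (-(2 * Complex.I * b * (deriv u (n + 1) * u (-(n + 1)) + u (n + 1) * deriv u (-(n + 1))))) * he
  have := tendsto_nhds_unique (hlim.congr fun n => (heq n).symm) hlim2
  rw [add_zero] at this
  rw [← this]; ring

end IsModifiedSolution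

/-! ### Nonvanishing of the amplitudes -/

namespace IsModifiedSolution

variable {a ev : ℂ} {b : ℝ} {u : ℂ → ℂ}

/-- If the incoming amplitude vanishes, the solution decays along the positive imaginary axis. -/
theorem decay_of_incoming_eq_zero (h : IsModifiedSolution a ev b u) (hb : 0 < b) {p : ℂ} {C : ℝ}
    (hA : HasAmplitudes b u p 0 C) (hp : p ≠ 0) {w : ℂ}
    (hw : ∀ z ≠ 0, deriv u z * u (-z) + u z * deriv u (-z) - a / z ^ 2 * (u z * u (-z)) = w) :
    ∃ M, ∀ s : ℝ, 0 ≤ s → ‖u (Complex.I * s)‖ ≤ M * Real.exp (-(b * s)) := by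
  obtain ⟨M, hM0, hM⟩ := h.exists_upper_bound hb
  have hp0 : 0 < ‖p‖ := norm_pos_iff.2 hp
  have hC0 := hA.nonneg
  have hud := h.differentiable
  set c : ℝ := ‖p‖ / (4 * b) with hc
  have hc0 : 0 < c := by positivity
  set s₀ : ℝ := max 1 (2 * C / ‖p‖) with hs₀
  have hexpn : ∀ s : ℝ, ‖Complex.exp (Complex.I * b * (Complex.I * s))‖ = Real.exp (-(b * s)) := fun s => by
    rw [norm_exp_I_mul_mul]; simp
  have hvlow : ∀ s : ℝ, s₀ ≤ s → c * Real.exp (b * s) ≤ ‖u (-(Complex.I * s))‖ := by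
    intro s hs
    have hs1 : 1 ≤ s := (le_max_left _ _).trans hs
    have hs2 : 2 * C ≤ s * ‖p‖ := (div_le_iff₀ hp0).1 ((le_max_right _ _).trans hs)
    have h1 := hA.comp_neg.upper (Complex.I * s) (by simp; linarith)
    set X := 2 * Complex.I * b * u (-(Complex.I * s)) * Complex.exp (Complex.I * b * (Complex.I * s))
    simp only [Complex.mul_im, Complex.I_re, Complex.I_im, Complex.ofReal_im, Complex.ofReal_re] at h1
    have h2 : ‖X + -p‖ ≤ ‖p‖ / 2 := by
      have : ‖X + -p‖ * s ≤ C := by simpa using h1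
      nlinarith [norm_nonneg (X + -p)]
    have h3 : ‖p‖ / 2 ≤ ‖X‖ := by
      have := norm_sub_le X (X + -p)
      rw [show X - (X + -p) = p by ring] at this
      linarith
    have h4 : ‖X‖ = 2 * b * ‖u (-(Complex.I * s))‖ * Real.exp (-(b * s)) := by
      simp only [X]
      rw [norm_mul, hexpn]
      simp [abs_of_pos hb]
    rw [h4, Real.exp_neg, ← div_eq_mul_inv, le_div_iff₀ (Real.exp_pos _)] at h3
    rw [hc, div_mul_eq_mul_div, div_le_iff₀ (by positivity)]
    linarith
  have hvne : ∀ s : ℝ, s₀ ≤ s → u (-(Complex.I * s)) ≠ 0 := fun s hs => by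
    rw [← norm_pos_iff]
    exact lt_of_lt_of_le (by positivity) (hvlow s hs)
  have hIs : ∀ s : ℝ, s₀ ≤ s → Complex.I * s ≠ 0 := fun s hs => by
    have : 1 ≤ s := (le_max_left _ _).trans hs
    simp; linarith
  have hea : ∀ s : ℝ, s₀ ≤ s → ‖Complex.exp (a / (Complex.I * s))‖ ≤ Real.exp ‖a‖ := fun s hs => by
    have hs1 : 1 ≤ s := (le_max_left _ _).trans hs
    refine (Complex.norm_exp_le_exp_norm _).trans (Real.exp_le_exp.2 ?_)
    rw [norm_div, norm_mul, Complex.norm_I, one_mul, Complex.norm_of_nonneg (by linarith)]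
    exact div_le_self (norm_nonneg _) hs1
  -- Reduction of order: by the Wronskian identity the derivative of this quotient is w e^{a/z} /
  -- u(-z)². On the positive imaginary axis p ≠ 0 makes u(-z) of size at least c e^{bs}, so the
  -- derivative is O(e^{-2bs}).
  set r : ℂ → ℂ := fun z => Complex.exp (a / z) * u z / u (-z) with hr
  have hrd : ∀ z ≠ 0, u (-z) ≠ 0 → HasDerivAt r (w * Complex.exp (a / z) / u (-z) ^ 2) z := by
    intro z hz hz'
    have e : HasDerivAt (fun z : ℂ => Complex.exp (a / z)) (Complex.exp (a / z) * (a * -(z ^ 2)⁻¹)) z :=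
      ((hasDerivAt_inv hz).const_mul a).cexp
    have n0 : HasDerivAt (fun z => u (-z)) (deriv u (-z) * -1) z :=
      (hud (-z)).hasDerivAt.comp z (hasDerivAt_neg z)
    refine ((e.mul (hud z).hasDerivAt).div n0 hz').congr_deriv ?_
    rw [← hw z hz]
    simp only [Pi.mul_apply]
    field_simp
    ring
  set K : ℝ := ‖w‖ * Real.exp ‖a‖ / c ^ 2 with hK
  have hK0 : 0 ≤ K := by positivity
  have hrs : ∀ s : ℝ, s₀ ≤ s → HasDerivAt (fun s : ℝ => r (Complex.I * s))
      (w * Complex.exp (a / (Complex.I * s)) / u (-(Complex.I * s)) ^ 2 * Complex.I) s := by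
    intro s hs
    have hl : HasDerivAt (fun s : ℝ => Complex.I * (s : ℂ)) Complex.I s := by
      simpa using (Complex.ofRealCLM.hasDerivAt (x := s)).const_mul Complex.I
    exact HasDerivAt.comp (h₂ := r) s (hrd _ (hIs s hs) (hvne s hs)) hl
  have hrb : ∀ s : ℝ, s₀ ≤ s →
      ‖w * Complex.exp (a / (Complex.I * s)) / u (-(Complex.I * s)) ^ 2 * Complex.I‖
        ≤ K * Real.exp (-(2 * b * s)) := by
    intro s hs
    rw [norm_mul, Complex.norm_I, mul_one, norm_div, norm_mul, norm_pow]
    calc ‖w‖ * ‖Complex.exp (a / (Complex.I * s))‖ / ‖u (-(Complex.I * s))‖ ^ 2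
        ≤ ‖w‖ * Real.exp ‖a‖ / (c * Real.exp (b * s)) ^ 2 := by
          gcongr
          · exact hea s hs
          · exact hvlow s hs
      _ = _ := by
          rw [hK, mul_pow, ← Real.exp_nat_mul, Real.exp_neg,
            show ((2 : ℕ) : ℝ) * (b * s) = 2 * b * s by push_cast; ring]
          field_simp
  -- Here the vanishing incoming amplitude enters: u(is) = O(e^{bs}/s), against the lower bound c
  -- e^{bs} for u(-is).
  have hr0 : Tendsto (fun t : ℝ => r (Complex.I * t)) atTop (𝓝 0) := by
    rw [tendsto_zero_iff_norm_tendsto_zero]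
    have hb2 : Tendsto (fun t : ℝ => Real.exp ‖a‖ * (C / (2 * b)) / c * t⁻¹) atTop (𝓝 0) := by
      simpa using tendsto_inv_atTop_zero.const_mul (Real.exp ‖a‖ * (C / (2 * b)) / c)
    refine squeeze_zero' (Eventually.of_forall fun _ => norm_nonneg _) ?_ hb2
    filter_upwards [eventually_ge_atTop s₀] with t ht
    have ht1 : 1 ≤ t := (le_max_left _ _).trans ht
    have ht0 : 0 < t := by linarith
    have h1 := hA.upper (Complex.I * t) (by simp; linarith)
    rw [add_zero, norm_mul, hexpn] at h1
    have h2 : ‖2 * Complex.I * b * u (Complex.I * t)‖ = 2 * b * ‖u (Complex.I * t)‖ := by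
      simp [abs_of_pos hb]
    rw [h2] at h1
    have h3 : 2 * b * ‖u (Complex.I * t)‖ * Real.exp (-(b * t)) * t ≤ C := by simpa using h1
    have h4 : ‖u (Complex.I * t)‖ ≤ C / (2 * b) * t⁻¹ * Real.exp (b * t) := by
      rw [Real.exp_neg] at h3
      have hX := Real.exp_pos (b * t)
      rw [← div_eq_mul_inv, div_mul_eq_mul_div, div_le_iff₀ hX] at h3
      rw [← div_eq_mul_inv, div_div, div_mul_eq_mul_div, le_div_iff₀ (by positivity)]
      linarith
    simp only [hr]
    rw [norm_div, norm_mul]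
    calc _ ≤ Real.exp ‖a‖ * (C / (2 * b) * t⁻¹ * Real.exp (b * t)) / (c * Real.exp (b * t)) := by
          gcongr
          · exact hea t ht
          · exact hvlow t ht
      _ = _ := by
          have hX := (Real.exp_pos (b * t)).ne'
          field_simp
  -- Integration of the derivative bound from s to t, followed by t → ∞.
  have hrdecay : ∀ s : ℝ, s₀ ≤ s → ‖r (Complex.I * s)‖ ≤ K / (2 * b) * Real.exp (-(2 * b * s)) := by
    intro s hs
    have hst : ∀ t : ℝ, s ≤ t → ‖r (Complex.I * t) - r (Complex.I * s)‖
        ≤ K / (2 * b) * Real.exp (-(2 * b * s)) := by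
      intro t hst
      have hB : ∀ x : ℝ, HasDerivAt (fun x : ℝ => K / (2 * b) * Real.exp (-(2 * b * s))
          - K / (2 * b) * Real.exp (-(2 * b * x))) (K * Real.exp (-(2 * b * x))) x := by
        intro x
        have h1 : HasDerivAt (fun x : ℝ => Real.exp (-(2 * b * x)))
            (Real.exp (-(2 * b * x)) * -(2 * b * 1)) x :=
          (((hasDerivAt_id x).const_mul (2 * b)).neg).exp
        refine ((h1.const_mul (K / (2 * b))).const_sub _).congr_deriv ?_
        field_simp
      have := image_norm_le_of_norm_deriv_right_le_deriv_boundary'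
        (f := fun x : ℝ => r (Complex.I * x) - r (Complex.I * s)) (a := s) (b := t)
        (fun x hx => ((hrs x (hs.trans hx.1)).sub_const _).continuousAt.continuousWithinAt)
        (fun x hx => ((hrs x (hs.trans hx.1)).sub_const _).hasDerivWithinAt)
        (B := fun x : ℝ => K / (2 * b) * Real.exp (-(2 * b * s)) - K / (2 * b) * Real.exp (-(2 * b * x)))
        (by simp) (fun x _ => (hB x).continuousAt.continuousWithinAt)
        (fun x _ => (hB x).hasDerivWithinAt) (fun x hx => hrb x (hs.trans hx.1)) ⟨hst, le_rfl⟩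
      refine this.trans ?_
      have : 0 ≤ K / (2 * b) * Real.exp (-(2 * b * t)) := by positivity
      linarith
    have hl : Tendsto (fun t : ℝ => ‖r (Complex.I * t) - r (Complex.I * s)‖) atTop
        (𝓝 ‖0 - r (Complex.I * s)‖) := (hr0.sub_const _).norm
    rw [zero_sub, norm_neg] at hl
    exact le_of_tendsto hl (by filter_upwards [eventually_ge_atTop s] with t ht using hst t ht)
  obtain ⟨N, hN⟩ := (isCompact_Icc (a := (0 : ℝ)) (b := s₀)).exists_bound_of_continuousOn
    (f := fun s : ℝ => u (Complex.I * s)) (by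
      have := hud.continuous
      fun_prop)
  have hN0 : 0 ≤ N := (norm_nonneg _).trans (hN 0 ⟨le_rfl, by positivity⟩)
  refine ⟨Real.exp ‖a‖ * (K / (2 * b)) * M + N * Real.exp (b * s₀), fun s hs => ?_⟩
  rcases le_total s₀ s with hss | hss
  · have h1 : ‖u (Complex.I * s)‖ = ‖Complex.exp (-(a / (Complex.I * s)))‖ * ‖r (Complex.I * s)‖
        * ‖u (-(Complex.I * s))‖ := by
      rw [← norm_mul, ← norm_mul, hr]
      congr 1
      have := hvne s hss
      rw [Complex.exp_neg]
      field_simp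
    have h2 : ‖Complex.exp (-(a / (Complex.I * s)))‖ ≤ Real.exp ‖a‖ := by
      have hs1 : 1 ≤ s := (le_max_left _ _).trans hss
      refine (Complex.norm_exp_le_exp_norm _).trans (Real.exp_le_exp.2 ?_)
      rw [norm_neg, norm_div, norm_mul, Complex.norm_I, one_mul, Complex.norm_of_nonneg (by linarith)]
      exact div_le_self (norm_nonneg _) hs1
    have h3 := (hM (-(Complex.I * s))).1
    simp only [Complex.neg_im, Complex.mul_im, Complex.I_re, Complex.ofReal_im, mul_zero, Complex.I_im,
      Complex.ofReal_re, one_mul, zero_add, abs_neg, abs_of_nonneg hs] at h3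
    rw [h1]
    calc _ ≤ Real.exp ‖a‖ * (K / (2 * b) * Real.exp (-(2 * b * s))) * (M * Real.exp (b * s)) := by
          gcongr
          exact hrdecay s hss
      _ = Real.exp ‖a‖ * (K / (2 * b)) * M * (Real.exp (-(2 * b * s)) * Real.exp (b * s)) := by ring
      _ = Real.exp ‖a‖ * (K / (2 * b)) * M * Real.exp (-(b * s)) := by
          rw [← Real.exp_add]; congr 2; ring
      _ ≤ _ := by
          gcongr
          exact le_add_of_nonneg_right (by positivity)
  · calc ‖u (Complex.I * s)‖ ≤ N := hN s ⟨hs, hss⟩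
      _ = N * 1 := by ring
      _ ≤ N * (Real.exp (b * s₀) * Real.exp (-(b * s))) := by
          gcongr
          rw [← Real.exp_add]
          exact Real.one_le_exp (by nlinarith)
      _ = N * Real.exp (b * s₀) * Real.exp (-(b * s)) := by ring
      _ ≤ _ := by
          gcongr
          exact le_add_of_nonneg_left (by positivity)

/-- If q = 0, the Wronskian relation gives p ≠ 0, so u decays on the positive imaginary axis. Then u
e^{-ibz} is bounded in the upper half plane by Phragmén–Lindelöf and in the lower one by the growth
bound. By Liouville it is constant; its value at 0 is 0, so u = 0, contradicting w ≠ 0. -/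
theorem incoming_ne_zero (h : IsModifiedSolution a ev b u) (hb : 0 < b) {p q : ℂ} {C : ℝ}
    (hA : HasAmplitudes b u p q C) (hu0 : u 0 = 0) {w : ℂ} (hw0 : w ≠ 0)
    (hw : ∀ z ≠ 0, deriv u z * u (-z) + u z * deriv u (-z) - a / z ^ 2 * (u z * u (-z)) = w) :
    q ≠ 0 := by
  rintro rfl
  have hpq := h.amplitude_wronskian hb hA hw
  have hp : p ≠ 0 := by
    rintro rfl
    apply hw0
    have : (2 * Complex.I * (b : ℂ)) ≠ 0 := by simp [hb.ne']
    simpa [this] using hpq.symm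
  obtain ⟨M', hM'⟩ := h.decay_of_incoming_eq_zero hb hA hp hw
  obtain ⟨M, hM0, hM⟩ := h.exists_upper_bound hb
  set k : ℂ → ℂ := fun z => u z * Complex.exp (-(Complex.I * b * z)) with hk
  have hkd : Differentiable ℂ k := by
    have := h.differentiable
    fun_prop
  have hkn : ∀ z, ‖k z‖ = ‖u z‖ * Real.exp (b * z.im) := fun z => by
    rw [hk, norm_mul, Complex.norm_exp]; simp
  have hupper : ∀ z : ℂ, 0 ≤ z.im → ‖k z‖ ≤ M := by
    intro z hz
    refine norm_le_of_bounded_on_real_of_bounded_on_imag hkd (A := M) (B := 2 * b) (M' := M')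
      (fun z => ?_) (fun x => ?_) (fun y hy => ?_) hz
    · rw [hkn]
      calc _ ≤ M * Real.exp (b * |z.im|) * Real.exp (b * |z.im|) := by
            gcongr
            · exact (hM z).1
            · exact le_abs_self _
        _ = M * Real.exp (2 * b * |z.im|) := by rw [mul_assoc, ← Real.exp_add]; congr 2; ring
        _ ≤ _ := by gcongr; exact Complex.abs_im_le_norm z
    · rw [hkn]; simpa using (hM x).1
    · rw [hkn]
      have := hM' y hy
      rw [Real.exp_neg, ← div_eq_mul_inv, le_div_iff₀ (Real.exp_pos _)] at this
      simpa using this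
  have hbd : ∀ z, ‖k z‖ ≤ M := by
    intro z
    rcases le_total 0 z.im with hz | hz
    · exact hupper z hz
    · rw [hkn]
      have := (hM z).1
      rw [abs_of_nonpos hz, mul_neg, Real.exp_neg, ← div_eq_mul_inv, le_div_iff₀ (Real.exp_pos _)] at this
      exact this
  have hz : ∀ z, u z = 0 := by
    intro z
    have hb' : Bornology.IsBounded (Set.range k) :=
      isBounded_iff_forall_norm_le.2 ⟨M, by rintro _ ⟨z, rfl⟩; exact hbd z⟩
    have := hkd.apply_eq_apply_of_bounded hb' z 0
    simpa [hk, hu0] using this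
  apply hw0
  rw [← hw 1 one_ne_zero]
  simp [hz]

theorem outgoing_ne_zero (h : IsModifiedSolution a ev b u) (hb : 0 < b) {p q : ℂ} {C : ℝ}
    (hA : HasAmplitudes b u p q C) (hu0 : u 0 = 0) {w : ℂ} (hw0 : w ≠ 0)
    (hw : ∀ z ≠ 0, deriv u z * u (-z) + u z * deriv u (-z) - a / z ^ 2 * (u z * u (-z)) = w) :
    p ≠ 0 := by
  refine neg_ne_zero.1 (h.comp_neg.incoming_ne_zero hb hA.comp_neg (by simpa using hu0)
    (neg_ne_zero.2 hw0) fun z hz => ?_)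
  rw [← hw z hz, deriv_comp_neg' u]
  simp only [neg_neg]
  ring

end IsModifiedSolution

/-! ### Lower bounds off a strip and on large circles -/

theorem norm_exp_neg_I_mul_mul (b : ℝ) (z : ℂ) :
    ‖Complex.exp (-(Complex.I * b * z))‖ = Real.exp (b * z.im) := by
  rw [Complex.norm_exp]; simp

/-- Far from the real axis one exponential dominates, and its amplitude is nonzero. This confines
the zeros of u to a strip. -/
theorem HasAmplitudes.exists_lower_bound {b : ℝ} (hb : 0 < b) {u : ℂ → ℂ} {p q : ℂ} {C : ℝ}
    (hA : HasAmplitudes b u p q C) (hp : p ≠ 0) (hq : q ≠ 0) :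
    ∃ H c : ℝ, 0 < H ∧ 0 < c ∧ ∀ z : ℂ, H ≤ |z.im| → c * Real.exp (b * |z.im|) ≤ ‖u z‖ := by
  have hp0 : 0 < ‖p‖ := norm_pos_iff.2 hp
  have hq0 : 0 < ‖q‖ := norm_pos_iff.2 hq
  have hC := hA.nonneg
  set m := min ‖p‖ ‖q‖ with hm
  have hm0 : 0 < m := lt_min hp0 hq0
  have key : ∀ (X r : ℂ) (y : ℝ), m ≤ ‖r‖ → 1 + 2 * C / m ≤ y → ‖X - r‖ * y ≤ C → m / 2 ≤ ‖X‖ := by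
    intro X r y hr hy h
    have h1 : m + 2 * C ≤ y * m := by
      have := mul_le_mul_of_nonneg_right hy hm0.le
      rwa [add_mul, div_mul_cancel₀ _ hm0.ne', one_mul] at this
    have hy0 : 0 < y := lt_of_lt_of_le (by positivity) hy
    have h2 : ‖X - r‖ ≤ m / 2 := by nlinarith [norm_nonneg (X - r)]
    have h3 := norm_sub_le X (X - r)
    rw [sub_sub_cancel] at h3
    linarith
  refine ⟨1 + 2 * C / m, m / (4 * b), by positivity, by positivity, fun z hz => ?_⟩
  have hn : ‖2 * Complex.I * b * u z‖ = 2 * b * ‖u z‖ := by simp [abs_of_pos hb]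
  have hy : 0 < |z.im| := lt_of_lt_of_le (by positivity) hz
  have hmain : m / 2 ≤ 2 * b * ‖u z‖ * Real.exp (-(b * |z.im|)) := by
    rcases lt_or_ge 0 z.im with h | h
    · have h1 := key (2 * Complex.I * b * u z * Complex.exp (Complex.I * b * z)) (-q) z.im
        (by rw [norm_neg]; exact min_le_right _ _) (by rwa [abs_of_pos h] at hz)
        (by rw [sub_neg_eq_add]; exact hA.upper z h)
      rw [norm_mul, hn, norm_exp_I_mul_mul] at h1
      rwa [abs_of_pos h]
    · have h : z.im < 0 := lt_of_le_of_ne h (by simpa using hy)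
      have h1 := key _ p (-z.im) (min_le_left _ _) (by rwa [abs_of_neg h] at hz) (hA.lower z h)
      rw [norm_mul, hn, norm_exp_neg_I_mul_mul] at h1
      rw [abs_of_neg h]
      simpa using h1
  rw [Real.exp_neg, ← div_eq_mul_inv, le_div_iff₀ (Real.exp_pos _)] at hmain
  rw [div_mul_eq_mul_div, div_le_iff₀ (by positivity)]
  linarith

/-- On vertical lines through integers of fixed parity, e^{iπx} = τ is 1 or -1. In the squared
modulus the cross term is then -2τ Re(p q̄), independent of y. The parity is chosen to make it
nonnegative; the two squares have factors e^{-πy} and e^{πy}, so their sum is at least 2|p||q| by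
AM-GM. -/
theorem exists_trig_lower_bound {p q : ℂ} (hp : p ≠ 0) (hq : q ≠ 0) :
    ∃ (R : ℕ → ℝ) (c : ℝ), Tendsto R atTop atTop ∧ 0 < c ∧ ∀ n (x y : ℝ), |x| = R n →
      c ≤ ‖p * Complex.exp (Complex.I * (Real.pi / 2 : ℝ) * (x + y * Complex.I))
        - q * Complex.exp (-(Complex.I * (Real.pi / 2 : ℝ) * (x + y * Complex.I)))‖ := by
  have hp0 : 0 < ‖p‖ := norm_pos_iff.2 hp
  have hq0 : 0 < ‖q‖ := norm_pos_iff.2 hq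
  -- it is enough to find a sign
  have key : ∀ τ : ℝ, τ ^ 2 = 1 → τ * (p * (starRingEnd ℂ) q).re ≤ 0 → ∀ x y : ℝ,
      Complex.exp (Complex.I * (Real.pi / 2 : ℝ) * x) ^ 2 = τ →
      Real.sqrt (2 * (‖p‖ * ‖q‖)) ≤ ‖p * Complex.exp (Complex.I * (Real.pi / 2 : ℝ) * (x + y * Complex.I))
        - q * Complex.exp (-(Complex.I * (Real.pi / 2 : ℝ) * (x + y * Complex.I)))‖ := by
    intro τ hτ hre x y hx
    set E := Complex.exp (Complex.I * (Real.pi / 2 : ℝ) * x) with hE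
    set α := Real.exp (-(Real.pi / 2 * y)) with hα
    set β := Real.exp (Real.pi / 2 * y) with hβ
    have hαβ : α * β = 1 := by rw [hα, hβ, ← Real.exp_add]; simp
    have e1 : Complex.exp (Complex.I * (Real.pi / 2 : ℝ) * (x + y * Complex.I)) = E * α := by
      rw [hE, hα, Complex.ofReal_exp, ← Complex.exp_add]
      congr 1
      push_cast
      linear_combination (Real.pi / 2 * y : ℂ) * Complex.I_sq
    have e2 : Complex.exp (-(Complex.I * (Real.pi / 2 : ℝ) * (x + y * Complex.I))) = E * (τ * β) := by
      rw [Complex.exp_neg, e1]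
      have hE0 : E ≠ 0 := Complex.exp_ne_zero _
      have hα0 : (α : ℂ) ≠ 0 := by exact_mod_cast (Real.exp_pos _).ne'
      have h1 : (α : ℂ) * β = 1 := by exact_mod_cast hαβ
      have h2 : (τ : ℂ) ^ 2 = 1 := by exact_mod_cast hτ
      refine inv_eq_of_mul_eq_one_right ?_
      linear_combination τ * α * β * hx + τ ^ 2 * h1 + h2
    have hEn : ‖E‖ = 1 := by rw [hE, norm_exp_I_mul_mul]; simp
    rw [e1, e2, show p * (E * α) - q * (E * (τ * β)) = E * (p * α - q * (τ * β)) by ring, norm_mul, hEn,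
      one_mul, Real.sqrt_le_iff]
    refine ⟨norm_nonneg _, ?_⟩
    have hX : Complex.normSq (p * α) = (‖p‖ * α) ^ 2 := by
      rw [Complex.normSq_eq_norm_sq, norm_mul, Complex.norm_of_nonneg (Real.exp_pos _).le]
    have hY : Complex.normSq (q * (τ * β)) = (‖q‖ * β) ^ 2 := by
      have : |τ| = 1 := by rw [← sq_eq_sq₀ (abs_nonneg _) zero_le_one]; simpa using hτ
      rw [Complex.normSq_eq_norm_sq, norm_mul, norm_mul, Complex.norm_real, Complex.norm_real,
        Real.norm_eq_abs, this, one_mul, Real.norm_eq_abs, abs_of_pos (Real.exp_pos _)]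
    have hXY : (p * α * (starRingEnd ℂ) (q * (τ * β))).re = τ * (p * (starRingEnd ℂ) q).re := by
      have : p * α * (starRingEnd ℂ) (q * (τ * β)) = ((α * β * τ : ℝ) : ℂ) * (p * (starRingEnd ℂ) q) := by
        simp; ring
      rw [this, Complex.re_ofReal_mul, hαβ, one_mul]
    rw [← Complex.normSq_eq_norm_sq, Complex.normSq_sub, hX, hY, hXY]
    have : ‖p‖ * ‖q‖ = (‖p‖ * α) * (‖q‖ * β) := by linear_combination (-‖p‖ * ‖q‖) * hαβ
    nlinarith [sq_nonneg (‖p‖ * α - ‖q‖ * β)]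
  have hexp : ∀ (x : ℝ) (k : ℤ) (σ : ℂ), (x : ℂ) = 2 * k + σ →
      Complex.exp (Complex.I * (Real.pi / 2 : ℝ) * x) ^ 2 = Complex.exp (σ * (Real.pi * Complex.I)) := by
    intro x k σ hx
    rw [← Complex.exp_nat_mul, hx, show ((2 : ℕ) : ℂ) * (Complex.I * (Real.pi / 2 : ℝ) * (2 * k + σ))
      = σ * (Real.pi * Complex.I) + k * (2 * Real.pi * Complex.I) by push_cast; ring, Complex.exp_add,
      Complex.exp_int_mul_two_pi_mul_I, mul_one]
  have hlim : Tendsto (fun n : ℕ => 2 * (n : ℝ)) atTop atTop :=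
    tendsto_natCast_atTop_atTop.const_mul_atTop two_pos
  rcases le_total (p * (starRingEnd ℂ) q).re 0 with hs | hs
  · refine ⟨fun n => 2 * n, Real.sqrt (2 * (‖p‖ * ‖q‖)), hlim, by positivity, fun n x y hx =>
      key 1 (by norm_num) (by simpa using hs) x y ?_⟩
    rcases abs_eq (by positivity) |>.1 hx with h | h
    · rw [hexp x n 0 (by rw [h]; push_cast; ring)]; simp
    · rw [hexp x (-n) 0 (by rw [h]; push_cast; ring)]; simp
  · refine ⟨fun n => 2 * n + 1, Real.sqrt (2 * (‖p‖ * ‖q‖)), tendsto_atTop_add_const_right _ _ hlim,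
      by positivity, fun n x y hx => key (-1) (by norm_num) (by linarith) x y ?_⟩
    rcases abs_eq (by positivity) |>.1 hx with h | h
    · rw [hexp x n 1 (by rw [h]; push_cast; ring)]; simp
    · rw [hexp x (-n - 1) 1 (by rw [h]; push_cast; ring)]; simp

namespace IsModifiedSolution

variable {a ev : ℂ} {b : ℝ} {u : ℂ → ℂ}

/-- The incoming amplitude also converges in horizontal strips. -/
theorem exists_incoming_strip (h : IsModifiedSolution a ev b u) (hb : 0 < b) {p q : ℂ} {C : ℝ}
    (hA : HasAmplitudes b u p q C) {H : ℝ} (hH : 0 ≤ H) : ∃ C', 0 ≤ C' ∧ ∀ z : ℂ, |z.im| ≤ H → 1 ≤ |z.re| →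
      ‖(deriv u z - Complex.I * b * u z) * Complex.exp (Complex.I * b * z) - q‖ * |z.re| ≤ C' := by
  obtain ⟨M, hM0, hM⟩ := h.exists_upper_bound hb
  set K : ℝ := (‖a‖ * (M * Real.exp (b * H)) + (‖ev‖ + ‖a‖) * (M * Real.exp (b * H))) * Real.exp (b * H)
  have hK0 : 0 ≤ K := by positivity
  refine ⟨K * H + C, add_nonneg (by positivity) hA.nonneg, fun z hz hz1 => ?_⟩
  set Q : ℂ → ℂ := fun z => (deriv u z - Complex.I * b * u z) * Complex.exp (Complex.I * b * z) with hQ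
  have hx0 : 0 < |z.re| := by linarith
  -- Vertical transport from the real axis: the segment has length at most H and stays at distance
  -- at least |Re z| from 0, where Q' = O(|Re z|⁻²).
  have h1 : ‖Q z - Q z.re‖ ≤ K / |z.re| ^ 2 * ‖z - z.re‖ := by
    refine (convex_segment (𝕜 := ℝ) (z.re : ℂ) z).norm_image_sub_le_of_norm_hasDerivWithin_le
      (fun w _ => (h.hasDerivAt_incoming w).hasDerivWithinAt) (fun w hw => ?_)
      (left_mem_segment _ _ _) (right_mem_segment _ _ _)
    obtain ⟨α, β, hα, hβ, hαβ, rfl⟩ := hw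
    set w : ℂ := α • (z.re : ℂ) + β • z with hw
    have hwre : w.re = z.re := by
      simp only [hw, Complex.add_re, Complex.real_smul, Complex.re_ofReal_mul, Complex.ofReal_re]
      rw [← add_mul, hαβ, one_mul]
    have hwim : |w.im| ≤ H := by
      have : w.im = β * z.im := by simp [hw]
      rw [this, abs_mul, abs_of_nonneg hβ]
      nlinarith [abs_nonneg z.im]
    have hwn : |z.re| ≤ ‖w‖ := hwre ▸ Complex.abs_re_le_norm w
    have hexp : Real.exp (b * |w.im|) ≤ Real.exp (b * H) := by gcongr
    rw [norm_mul, norm_exp_I_mul_mul]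
    calc _ ≤ (‖a‖ * ‖deriv u w‖ + (‖ev‖ + ‖a‖) * ‖u w‖) / ‖w‖ ^ 2 * Real.exp (b * H) := by
          gcongr
          · exact h.norm_defect_le (hz1.trans hwn)
          · have := (abs_le.1 hwim).1
            nlinarith
      _ ≤ (‖a‖ * (M * Real.exp (b * H)) + (‖ev‖ + ‖a‖) * (M * Real.exp (b * H))) / |z.re| ^ 2
          * Real.exp (b * H) := by
          gcongr
          · exact (hM w).2.trans (by gcongr)
          · exact (hM w).1.trans (by gcongr)
      _ = _ := by ring
  have h2 : ‖Q z.re - q‖ * |z.re| ≤ C := by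
    have := hA.incoming z.re (by simp)
    rwa [Complex.norm_real, Real.norm_eq_abs] at this
  have h3 : ‖z - z.re‖ ≤ H := by
    have : z - z.re = z.im * Complex.I := by
      nth_rewrite 1 [← Complex.re_add_im z]; ring
    rw [this]
    simpa using hz
  have h4 : ‖Q z - Q z.re‖ ≤ K * H / |z.re| := by
    refine h1.trans ?_
    calc K / |z.re| ^ 2 * ‖z - z.re‖ ≤ K / |z.re| * H := by
          gcongr
          exact le_self_pow₀ hz1 two_ne_zero
      _ = _ := by ring
  rw [le_div_iff₀ hx0] at h4
  have h5 : ‖Q z - q‖ ≤ ‖Q z - Q z.re‖ + ‖Q z.re - q‖ := norm_sub_le_norm_sub_add_norm_sub _ _ _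
  nlinarith

/-- The incoming component of u at z approximates q; that of u(-·), evaluated at -z, approximates
-p. Eliminating u' between the two isolates 2ibu. -/
theorem exists_trig_approx (h : IsModifiedSolution a ev b u) (hb : 0 < b) {p q : ℂ} {C : ℝ}
    (hA : HasAmplitudes b u p q C) {H : ℝ} (hH : 0 ≤ H) : ∃ C', 0 ≤ C' ∧ ∀ z : ℂ, |z.im| ≤ H → 1 ≤ |z.re| →
      ‖2 * Complex.I * b * u z - (p * Complex.exp (Complex.I * b * z)
        - q * Complex.exp (-(Complex.I * b * z)))‖ * |z.re| ≤ C' := by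
  obtain ⟨C₁, h1, hq⟩ := h.exists_incoming_strip hb hA hH
  obtain ⟨C₂, h2, hp⟩ := h.comp_neg.exists_incoming_strip hb hA.comp_neg hH
  refine ⟨(C₂ + C₁) * Real.exp (b * H), by positivity, fun z hz hz1 => ?_⟩
  have hq' := hq z hz hz1
  have hp' := hp (-z) (by simpa using hz) (by simpa using hz1)
  rw [deriv_comp_neg' u] at hp'
  simp only [neg_neg, Complex.neg_re, abs_neg, mul_neg] at hp'
  set e := Complex.exp (Complex.I * b * z) with he
  set e' := Complex.exp (-(Complex.I * b * z)) with he'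
  have hee : e * e' = 1 := by rw [he, he', ← Complex.exp_add]; simp
  have hen : ‖e‖ ≤ Real.exp (b * H) := by
    rw [he, norm_exp_I_mul_mul]
    have := (abs_le.1 hz).1
    gcongr
    nlinarith
  have hen' : ‖e'‖ ≤ Real.exp (b * H) := by
    rw [he', norm_exp_neg_I_mul_mul]
    have := (abs_le.1 hz).2
    gcongr
  have hid : 2 * Complex.I * b * u z - (p * e - q * e')
      = -((-deriv u z - Complex.I * b * u z) * e' - -p) * e
        - ((deriv u z - Complex.I * b * u z) * e - q) * e' := by
    linear_combination (-(2 * Complex.I * b * u z)) * hee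
  rw [hid]
  calc _ ≤ (‖(-deriv u z - Complex.I * b * u z) * e' - -p‖ * ‖e‖
        + ‖(deriv u z - Complex.I * b * u z) * e - q‖ * ‖e'‖) * |z.re| := by
        gcongr
        refine (norm_sub_le _ _).trans ?_
        rw [norm_mul, norm_mul, norm_neg]
    _ = (‖(-deriv u z - Complex.I * b * u z) * e' - -p‖ * |z.re|) * ‖e‖
        + (‖(deriv u z - Complex.I * b * u z) * e - q‖ * |z.re|) * ‖e'‖ := by ring
    _ ≤ C₂ * Real.exp (b * H) + C₁ * Real.exp (b * H) := by gcongr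
    _ = _ := by ring

end IsModifiedSolution

theorem norm_exp_sub_exp_le (b : ℝ) (z w : ℂ) (h : z.im = w.im) :
    ‖Complex.exp (Complex.I * b * z) - Complex.exp (Complex.I * b * w)‖
      ≤ Real.exp (-(b * w.im)) * (|b| * |z.re - w.re|) := by
  have hzw : z - w = ((z.re - w.re : ℝ) : ℂ) := by
    apply Complex.ext <;> simp [h]
  have h1 : Complex.exp (Complex.I * b * z) - Complex.exp (Complex.I * b * w)
      = Complex.exp (Complex.I * b * w) * (Complex.exp (Complex.I * ((b * (z.re - w.re) : ℝ) : ℂ)) - 1) := by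
    rw [mul_sub, ← Complex.exp_add, mul_one, Complex.ofReal_mul, ← hzw]
    congr 2
    ring
  rw [h1, norm_mul, norm_exp_I_mul_mul, ← abs_mul, ← Real.norm_eq_abs (b * _)]
  gcongr
  exact Real.norm_exp_I_mul_ofReal_sub_one_le

/-- Outside the strip the dominant exponential suffices. Inside it, a circle of radius R n is within
H²/R n of the vertical lines |x| = R n, where the trigonometric lower bound holds; that displacement
and the approximation error are both O(1/R n). -/
theorem IsModifiedSolution.exists_circles {a ev : ℂ} {u : ℂ → ℂ}
    (h : IsModifiedSolution a ev (Real.pi / 2) u) {p q : ℂ} {C : ℝ}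
    (hA : HasAmplitudes (Real.pi / 2) u p q C) (hp : p ≠ 0) (hq : q ≠ 0) :
    ∃ (R : ℕ → ℝ) (c : ℝ), Tendsto R atTop atTop ∧ 0 < c ∧ ∀ᶠ n in atTop, ∀ z : ℂ, ‖z‖ = R n →
      c * Real.exp (Real.pi / 2 * |z.im|) ≤ ‖u z‖ := by
  set b : ℝ := Real.pi / 2 with hbdef
  have hb : 0 < b := by positivity
  obtain ⟨H, c₁, hH, hc₁, hlow⟩ := hA.exists_lower_bound hb hp hq
  obtain ⟨R, c₂, hR, hc₂, htrig⟩ := exists_trig_lower_bound hp hq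
  obtain ⟨C', hC', happ⟩ := h.exists_trig_approx hb hA hH.le
  set A : ℝ := (‖p‖ + ‖q‖) * (Real.exp (b * H) * (b * H ^ 2)) with hAdef
  have hA0 : 0 ≤ A := by positivity
  refine ⟨R, min c₁ (c₂ / (4 * b) / Real.exp (b * H)), hR, lt_min hc₁ (by positivity), ?_⟩
  filter_upwards [hR.eventually_ge_atTop (2 + 2 * H + 2 * (A + 2 * C') / c₂)] with n hn z hz
  have hfr : 0 ≤ 2 * (A + 2 * C') / c₂ := by positivity
  have hRn : 0 < R n := by linarith
  rcases le_total H |z.im| with hzH | hzH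
  · refine le_trans ?_ (hlow z hzH)
    gcongr
    exact min_le_left _ _
  have hsq : z.re ^ 2 + z.im ^ 2 = R n ^ 2 := by
    rw [← hz, ← Complex.normSq_eq_norm_sq, Complex.normSq_apply]; ring
  have hxR : |z.re| ≤ R n := hz ▸ Complex.abs_re_le_norm z
  -- (R - |x|)R ≤ (R - |x|)(R + |x|) = y² ≤ H².
  have hgap : (R n - |z.re|) * R n ≤ H ^ 2 := by
    have h1 : z.im ^ 2 ≤ H ^ 2 := by rw [← sq_abs z.im]; gcongr
    nlinarith [sq_abs z.re, abs_nonneg z.re]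
  have hxhalf : R n / 2 ≤ |z.re| := by nlinarith [abs_nonneg z.re]
  have hx1 : 1 ≤ |z.re| := by linarith
  obtain ⟨x, hxn, hxd⟩ : ∃ x : ℝ, |x| = R n ∧ |z.re - x| = R n - |z.re| := by
    rcases le_total 0 z.re with hs | hs
    · exact ⟨R n, abs_of_pos hRn, by
        rw [abs_of_nonneg hs] at hxR ⊢; rw [abs_of_nonpos (by linarith)]; ring⟩
    · exact ⟨-R n, by rw [abs_neg, abs_of_pos hRn], by
        rw [abs_of_nonpos hs] at hxR ⊢; rw [abs_of_nonneg (by linarith)]; ring⟩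
  have hd : |z.re - x| ≤ H ^ 2 / R n := by rw [hxd, le_div_iff₀ hRn]; exact hgap
  have ht := htrig n x z.im hxn
  set w : ℂ := x + z.im * Complex.I with hw
  have hwre : w.re = x := by simp [hw]
  have hwim : w.im = z.im := by simp [hw]
  have d1 : ‖Complex.exp (Complex.I * b * z) - Complex.exp (Complex.I * b * w)‖
      ≤ Real.exp (b * H) * (b * (H ^ 2 / R n)) := by
    refine (norm_exp_sub_exp_le b z w hwim.symm).trans ?_
    rw [hwre, abs_of_pos hb, hwim, ← mul_neg]
    gcongr
    linarith [(abs_le.1 hzH).1]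
  have d2 : ‖Complex.exp (-(Complex.I * b * z)) - Complex.exp (-(Complex.I * b * w))‖
      ≤ Real.exp (b * H) * (b * (H ^ 2 / R n)) := by
    have := norm_exp_sub_exp_le b (-z) (-w) (by simp [hwim])
    simp only [mul_neg, Complex.neg_im, Complex.neg_re, neg_neg] at this
    refine this.trans ?_
    rw [hwre, abs_of_pos hb, hwim, neg_sub_neg, abs_sub_comm]
    gcongr
    exact (abs_le.1 hzH).2
  set T : ℂ → ℂ := fun z => p * Complex.exp (Complex.I * b * z) - q * Complex.exp (-(Complex.I * b * z)) with hT
  have hTd : ‖T z - T w‖ ≤ A / R n := by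
    have : T z - T w = p * (Complex.exp (Complex.I * b * z) - Complex.exp (Complex.I * b * w))
        - q * (Complex.exp (-(Complex.I * b * z)) - Complex.exp (-(Complex.I * b * w))) := by
      simp only [hT]; ring
    rw [this]
    refine (norm_sub_le _ _).trans ?_
    rw [norm_mul, norm_mul]
    calc _ ≤ ‖p‖ * (Real.exp (b * H) * (b * (H ^ 2 / R n))) + ‖q‖ * (Real.exp (b * H) * (b * (H ^ 2 / R n))) := by
          gcongr
      _ = _ := by rw [hAdef]; ring
  have hap : ‖2 * Complex.I * b * u z - T z‖ ≤ 2 * C' / R n := by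
    have := happ z hzH hx1
    rw [le_div_iff₀ hRn]
    nlinarith [norm_nonneg (2 * Complex.I * b * u z - T z)]
  have herr : A / R n + 2 * C' / R n ≤ c₂ / 2 := by
    rw [← add_div, div_le_iff₀ hRn]
    have : 2 * (A + 2 * C') / c₂ ≤ R n := by linarith
    rw [div_le_iff₀ hc₂] at this
    linarith
  have ht' : c₂ ≤ ‖T w‖ := ht
  have hfin : c₂ / 2 ≤ 2 * b * ‖u z‖ := by
    have h1 : ‖2 * Complex.I * b * u z‖ = 2 * b * ‖u z‖ := by simp [abs_of_pos hb]
    rw [← h1]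
    have h2 : T w = 2 * Complex.I * b * u z - (2 * Complex.I * b * u z - T z) - (T z - T w) := by ring
    have h3 : ‖T w‖ ≤ ‖2 * Complex.I * b * u z‖ + ‖2 * Complex.I * b * u z - T z‖ + ‖T z - T w‖ := by
      nth_rewrite 1 [h2]
      exact (norm_sub_le _ _).trans (by gcongr; exact norm_sub_le _ _)
    linarith
  calc _ ≤ c₂ / (4 * b) / Real.exp (b * H) * Real.exp (b * H) := by
        gcongr
        exact min_le_right _ _
    _ = c₂ / (4 * b) := div_mul_cancel₀ _ (Real.exp_pos _).ne'
    _ ≤ ‖u z‖ := by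
        rw [div_le_iff₀ (by positivity)]; linarith

/-! ### Paley–Wiener estimates: Phragmén–Lindelöf, Plancherel–Pólya, separated points -/

theorem HasExpTypeAtMost.comp_neg {t : ℝ} {f : ℂ → ℂ} (h : HasExpTypeAtMost t f) :
    HasExpTypeAtMost t (fun z => f (-z)) := fun ε hε => by
  obtain ⟨C, hC⟩ := h ε hε
  exact ⟨C, fun z => by simpa using hC (-z)⟩

/-- Multiplication by e^{i(t+ε)z} makes F bounded on the positive imaginary axis without changing
its modulus on the real one. Phragmén–Lindelöf applies, and ε → 0. -/
theorem HasExpTypeAtMost.norm_le_of_im_nonneg {t M : ℝ} {F : ℂ → ℂ} (h : HasExpTypeAtMost t F)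
    (hF : Differentiable ℂ F) (hM : ∀ x : ℝ, ‖F x‖ ≤ M) {z : ℂ} (hz : 0 ≤ z.im) :
    ‖F z‖ ≤ M * Real.exp (t * z.im) := by
  have key : ∀ ε : ℝ, 0 < ε → ‖F z‖ ≤ M * Real.exp ((t + ε) * z.im) := by
    intro ε hε
    obtain ⟨C, hC⟩ := h ε hε
    have hC0 : 0 ≤ C := by
      have := (norm_nonneg _).trans (hC 0)
      simpa using this
    have := norm_le_of_bounded_on_real_of_bounded_on_imag
      (F := fun z => F z * Complex.exp (Complex.I * ((t + ε : ℝ) : ℂ) * z)) (by fun_prop)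
      (A := C) (B := (t + ε) + |t + ε|) (M := M) (M' := C)
      (fun z => ?_) (fun x => ?_) (fun y hy => ?_) hz
    · rw [norm_mul, norm_exp_I_mul_mul, Real.exp_neg, ← div_eq_mul_inv, div_le_iff₀ (Real.exp_pos _)] at this
      exact this
    · rw [norm_mul, norm_exp_I_mul_mul, add_mul (t + ε), Real.exp_add, ← mul_assoc]
      gcongr
      · exact hC z
      · calc -((t + ε) * z.im) ≤ |(t + ε) * z.im| := neg_le_abs _
          _ = |t + ε| * |z.im| := abs_mul _ _
          _ ≤ |t + ε| * ‖z‖ := by gcongr; exact Complex.abs_im_le_norm z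
    · rw [norm_mul, norm_exp_I_mul_mul]; simpa using hM x
    · rw [norm_mul, norm_exp_I_mul_mul, Real.exp_neg, ← div_eq_mul_inv, div_le_iff₀ (Real.exp_pos _)]
      simpa [abs_of_nonneg hy] using hC (Complex.I * y)
  have hlim : Tendsto (fun ε : ℝ => M * Real.exp ((t + ε) * z.im)) (𝓝[>] 0) (𝓝 (M * Real.exp (t * z.im))) := by
    refine Tendsto.mono_left ?_ nhdsWithin_le_nhds
    exact Continuous.tendsto' (by fun_prop) _ _ (by simp)
  exact ge_of_tendsto hlim (by filter_upwards [self_mem_nhdsWithin] with ε hε using key ε hε)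

theorem HasExpTypeAtMost.norm_le {t M : ℝ} {F : ℂ → ℂ} (h : HasExpTypeAtMost t F)
    (hF : Differentiable ℂ F) (hM : ∀ x : ℝ, ‖F x‖ ≤ M) (z : ℂ) :
    ‖F z‖ ≤ M * Real.exp (t * |z.im|) := by
  rcases le_total 0 z.im with hz | hz
  · rw [abs_of_nonneg hz]; exact h.norm_le_of_im_nonneg hF hM hz
  · rw [abs_of_nonpos hz]
    have := h.comp_neg.norm_le_of_im_nonneg (by fun_prop) (M := M) (fun x => by
      simpa using hM (-x)) (z := -z) (by simpa using hz)
    simpa using this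

theorem differentiable_setIntegral_translate_mul {f : ℂ → ℂ} (hf : Differentiable ℂ f) {φ : ℝ → ℂ}
    (hφ : Measurable φ) (hφ1 : ∀ s, ‖φ s‖ ≤ 1) (T : ℝ) :
    Differentiable ℂ (fun z => ∫ s in Set.Icc (-T) T, f (z + s) * φ s) := by
  intro z₀
  have hfc := hf.continuous
  have hfc' := hf.deriv.continuous
  obtain ⟨B, hB⟩ := (isCompact_closedBall z₀ (1 + T)).exists_bound_of_continuousOn hfc'.continuousOn
  obtain ⟨B₀, hB₀⟩ := (isCompact_closedBall z₀ (1 + T)).exists_bound_of_continuousOn hfc.continuousOn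
  have hmem : ∀ s ∈ Set.Icc (-T) T, ∀ z ∈ Metric.ball z₀ 1, z + s ∈ Metric.closedBall z₀ (1 + T) := by
    intro s hs z hz
    rw [mem_closedBall_iff_norm, show z + s - z₀ = (z - z₀) + s by ring]
    refine (norm_add_le _ _).trans (add_le_add (mem_ball_iff_norm.1 hz).le ?_)
    rw [Complex.norm_real]
    exact abs_le.2 hs
  have hmeas : ∀ (g : ℂ → ℂ) (_ : Continuous g) (z : ℂ),
      AEStronglyMeasurable (fun s : ℝ => g (z + s) * φ s) (volume.restrict (Set.Icc (-T) T)) := fun g hg z =>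
    ((by fun_prop : Continuous fun s : ℝ => g (z + s)).aestronglyMeasurable).mul hφ.aestronglyMeasurable
  refine (hasDerivAt_integral_of_dominated_loc_of_deriv_le (bound := fun _ => B) (Metric.ball_mem_nhds z₀ one_pos)
    (Eventually.of_forall fun z => hmeas f hfc z) ?_ (F' := fun z s => deriv f (z + s) * φ s)
    (hmeas _ hfc' z₀) ?_ ?_ ?_).2.differentiableAt
  · refine Integrable.of_bound (hmeas f hfc z₀) B₀ ?_
    filter_upwards [ae_restrict_mem measurableSet_Icc] with s hs
    rw [norm_mul]
    have h1 := hB₀ _ (hmem s hs z₀ (Metric.mem_ball_self one_pos))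
    nlinarith [hφ1 s, norm_nonneg (f (z₀ + s)), norm_nonneg (φ s)]
  · filter_upwards [ae_restrict_mem measurableSet_Icc] with s hs z hz
    rw [norm_mul]
    have h1 := hB _ (hmem s hs z hz)
    nlinarith [hφ1 s, norm_nonneg (deriv f (z + s)), norm_nonneg (φ s)]
  · exact integrable_const _
  · filter_upwards with s z _
    exact ((hf (z + s)).hasDerivAt.comp_add_const z (s : ℂ)).mul_const (φ s)

/-- The Plancherel–Pólya inequality in `L¹`. -/
theorem lintegral_enorm_horizontal_le {t : ℝ} {f : ℂ → ℂ} (hf : Differentiable ℂ f)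
    (ht : HasExpTypeAtMost t f) (hi : Integrable (fun x : ℝ => f x)) (y : ℝ) :
    ∫⁻ x : ℝ, ‖f (x + y * Complex.I)‖ₑ ≤ ENNReal.ofReal (Real.exp (t * |y|)) * ∫⁻ x : ℝ, ‖f x‖ₑ := by
  have hfc := hf.continuous
  set N := ∫ x : ℝ, ‖f x‖ with hN
  have hN0 : 0 ≤ N := integral_nonneg fun _ => norm_nonneg _
  have hNe : ENNReal.ofReal N = ∫⁻ x : ℝ, ‖f x‖ₑ := ofReal_integral_norm_eq_lintegral_enorm hi
  have hg : Continuous fun s : ℝ => f (s + y * Complex.I) := by fun_prop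
  have key : ∀ T : ℝ, ∫ s in Set.Icc (-T) T, ‖f (s + y * Complex.I)‖ ≤ N * Real.exp (t * |y|) := by
    intro T
    -- Duality: φ is the conjugate phase of f on the line at height y, so Φ(iy) is the truncated L¹
    -- norm there. On the real axis Φ is bounded by the L¹ norm N of f, and it inherits the type t,
    -- so the pointwise bound for Φ gives the integral bound for f.
    set φ : ℝ → ℂ := fun s => (starRingEnd ℂ) (f (s + y * Complex.I)) / ‖f (s + y * Complex.I)‖ with hφ
    have hφm : Measurable φ := by
      refine Measurable.div ?_ ?_
      · exact (Complex.continuous_conj.comp hg).measurable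
      · exact (Complex.continuous_ofReal.comp hg.norm).measurable
    have hφ1 : ∀ s, ‖φ s‖ ≤ 1 := fun s => by
      simp only [hφ, norm_div, RCLike.norm_conj, Complex.norm_real, norm_norm]
      exact div_self_le_one _
    set Φ : ℂ → ℂ := fun z => ∫ s in Set.Icc (-T) T, f (z + s) * φ s with hΦ
    have hΦt : HasExpTypeAtMost t Φ := by
      intro ε hε
      obtain ⟨C, hC⟩ := ht ε hε
      refine ⟨C * Real.exp (|t + ε| * |T|) * volume.real (Set.Icc (-T) T), fun z => ?_⟩
      have hC0 : 0 ≤ C := by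
        have := (norm_nonneg _).trans (hC 0)
        simpa using this
      have hb : ∀ s ∈ Set.Icc (-T) T, ‖f (z + s) * φ s‖
          ≤ C * Real.exp (|t + ε| * |T|) * Real.exp ((t + ε) * ‖z‖) := by
        intro s hs
        rw [norm_mul]
        have h1 : (t + ε) * ‖z + s‖ ≤ |t + ε| * |T| + (t + ε) * ‖z‖ := by
          have h2 : |‖z + s‖ - ‖z‖| ≤ |T| := by
            have := abs_norm_sub_norm_le (z + s) z
            rw [add_sub_cancel_left, Complex.norm_real, Real.norm_eq_abs] at this
            exact this.trans ((abs_le.2 hs).trans (le_abs_self T))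
          have h3 : (t + ε) * (‖z + s‖ - ‖z‖) ≤ |t + ε| * |T| :=
            (le_abs_self _).trans (by rw [abs_mul]; gcongr)
          linarith
        calc ‖f (z + s)‖ * ‖φ s‖ ≤ C * Real.exp ((t + ε) * ‖z + s‖) * 1 := by
              gcongr
              · exact hC _
              · exact hφ1 s
          _ ≤ C * Real.exp (|t + ε| * |T| + (t + ε) * ‖z‖) * 1 := by gcongr
          _ = _ := by rw [Real.exp_add]; ring
      refine (norm_setIntegral_le_of_norm_le_const (by simp) hb).trans (le_of_eq ?_)
      ring
    have hΦM : ∀ x : ℝ, ‖Φ x‖ ≤ N := by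
      intro x
      have hs : Integrable (fun s : ℝ => ‖f ((x + s : ℝ) : ℂ)‖) := hi.norm.comp_add_left x
      calc ‖Φ x‖ ≤ ∫ s in Set.Icc (-T) T, ‖f ((x + s : ℝ) : ℂ)‖ := by
            refine norm_integral_le_of_norm_le hs.integrableOn (Eventually.of_forall fun s => ?_)
            rw [norm_mul, Complex.ofReal_add]
            exact mul_le_of_le_one_right (norm_nonneg _) (hφ1 s)
        _ ≤ ∫ s, ‖f ((x + s : ℝ) : ℂ)‖ :=
            setIntegral_le_integral hs (Eventually.of_forall fun _ => norm_nonneg _)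
        _ = N := integral_add_left_eq_self (fun s : ℝ => ‖f s‖) x
    have h1 := hΦt.norm_le (differentiable_setIntegral_translate_mul hf hφm hφ1 T) hΦM (y * Complex.I)
    have h2 : Φ (y * Complex.I) = ((∫ s in Set.Icc (-T) T, ‖f (s + y * Complex.I)‖ : ℝ) : ℂ) := by
      rw [hΦ, ← integral_complex_ofReal]
      refine integral_congr_ae (Eventually.of_forall fun s => ?_)
      simp only [hφ]
      rw [add_comm (y * Complex.I) (s : ℂ), mul_div_assoc', Complex.mul_conj, Complex.normSq_eq_norm_sq]
      rcases eq_or_ne (f (s + y * Complex.I)) 0 with h0 | h0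
      · simp [h0]
      · have : (‖f (s + y * Complex.I)‖ : ℂ) ≠ 0 := by simpa using h0
        push_cast
        field_simp
    rw [h2, Complex.norm_real] at h1
    simpa using (le_abs_self _).trans h1
  have hlim := (aecover_Icc (μ := (volume : Measure ℝ)) tendsto_neg_atTop_atBot
    tendsto_id).comp_tendsto tendsto_natCast_atTop_atTop |>.lintegral_tendsto_of_nat
    (f := fun x : ℝ => ‖f (x + y * Complex.I)‖ₑ) hg.enorm.measurable.aemeasurable
  refine le_of_tendsto' hlim fun n => ?_
  have hint : IntegrableOn (fun s : ℝ => f (s + y * Complex.I)) (Set.Icc (-(n : ℝ)) n) :=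
    hg.continuousOn.integrableOn_compact isCompact_Icc
  have := ENNReal.ofReal_le_ofReal (key n)
  rw [ofReal_integral_norm_eq_lintegral_enorm hint, ENNReal.ofReal_mul hN0, hNe] at this
  exact this.trans_eq (mul_comm _ _)

theorem enorm_mul_two_pi_le_lintegral_circle {f : ℂ → ℂ} (hf : Differentiable ℂ f) (c : ℂ) (r : ℝ) :
    ‖f c‖ₑ * ENNReal.ofReal (2 * Real.pi) ≤ ∫⁻ θ in Set.Ioo (-Real.pi) Real.pi, ‖f (circleMap c r θ)‖ₑ := by
  have h1 : Real.circleAverage f c r = f c := hf.diffContOnCl.circleAverage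
  rw [Real.circleAverage_eq_integral_add (-Real.pi), intervalIntegral.integral_comp_add_right
    (fun θ => f (circleMap c r θ))] at h1
  have h2 : (∫ θ in (-Real.pi)..Real.pi, f (circleMap c r θ)) = (2 * Real.pi : ℝ) • f c := by
    rw [← h1, smul_smul, mul_inv_cancel₀ (by positivity), one_smul]
    congr 1 <;> ring
  have h3 := enorm_integral_le_lintegral_enorm (μ := volume.restrict (Set.Ioc (-Real.pi) Real.pi))
    (fun θ => f (circleMap c r θ))
  rw [← intervalIntegral.integral_of_le (by linarith [Real.pi_pos]), h2, enorm_smul, mul_comm,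
    Real.enorm_of_nonneg (by positivity), Measure.restrict_congr_set Ioo_ae_eq_Ioc.symm] at h3
  exact h3

/-- The area sub-mean value inequality. -/
theorem enorm_mul_le_lintegral_ball {f : ℂ → ℂ} (hf : Differentiable ℂ f) (c : ℂ) {ρ : ℝ} (hρ : 0 < ρ) :
    ENNReal.ofReal (Real.pi * ρ ^ 2) * ‖f c‖ₑ ≤ ∫⁻ z in Metric.ball c ρ, ‖f z‖ₑ := by
  have hfc := hf.continuous
  set g : ℂ → ENNReal := (Metric.ball (0 : ℂ) ρ).indicator fun z => ‖f (c + z)‖ₑ with hg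
  have hgm : Measurable g :=
    (by fun_prop : Continuous fun z => ‖f (c + z)‖ₑ).measurable.indicator measurableSet_ball
  have h1 : ∫⁻ z in Metric.ball c ρ, ‖f z‖ₑ = ∫⁻ z, g z := by
    rw [← lintegral_indicator measurableSet_ball, ← lintegral_add_left_eq_self _ c]
    refine lintegral_congr fun z => ?_
    by_cases hz : z ∈ Metric.ball (0 : ℂ) ρ
    · rw [hg, Set.indicator_of_mem hz, Set.indicator_of_mem (by simpa using hz)]
    · rw [hg, Set.indicator_of_notMem hz, Set.indicator_of_notMem (by simpa using hz)]
  have hpm : Measurable fun p : ℝ × ℝ => ENNReal.ofReal p.1 • g (Complex.polarCoord.symm p) := by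
    have : Measurable fun p : ℝ × ℝ => Complex.polarCoord.symm p := by
      simp only [Complex.polarCoord_symm_apply]
      fun_prop
    exact (ENNReal.measurable_ofReal.comp measurable_fst).smul (hgm.comp this)
  rw [h1, ← Complex.lintegral_comp_polarCoord_symm, polarCoord_target, Measure.volume_eq_prod,
    ← Measure.prod_restrict, lintegral_prod _ hpm.aemeasurable]
  calc ENNReal.ofReal (Real.pi * ρ ^ 2) * ‖f c‖ₑ
      = ∫⁻ r in Set.Ioo 0 ρ, ENNReal.ofReal r * (‖f c‖ₑ * ENNReal.ofReal (2 * Real.pi)) := by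
        rw [lintegral_mul_const _ ENNReal.measurable_ofReal, ← ofReal_integral_eq_lintegral_ofReal,
          Measure.restrict_congr_set Ioo_ae_eq_Ioc, ← intervalIntegral.integral_of_le hρ.le, integral_id,
          zero_pow two_ne_zero, sub_zero, mul_comm ‖f c‖ₑ, ← mul_assoc, ← ENNReal.ofReal_mul (by positivity)]
        · congr 2; ring
        · exact (continuous_id.continuousOn.integrableOn_compact isCompact_Icc).mono_set Set.Ioo_subset_Icc_self
        · filter_upwards [ae_restrict_mem measurableSet_Ioo] with r hr using hr.1.le
    _ ≤ ∫⁻ r in Set.Ioo 0 ρ, ∫⁻ θ in Set.Ioo (-Real.pi) Real.pi,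
          ENNReal.ofReal r • g (Complex.polarCoord.symm (r, θ)) := by
        refine setLIntegral_mono' measurableSet_Ioo fun r hr => ?_
        have he : ∀ θ, g (Complex.polarCoord.symm (r, θ)) = ‖f (circleMap c r θ)‖ₑ := by
          intro θ
          have hz : Complex.polarCoord.symm (r, θ) = r * Complex.exp (θ * Complex.I) := by
            simp [Complex.polarCoord_symm_apply, Complex.exp_mul_I]
          have hm : Complex.polarCoord.symm (r, θ) ∈ Metric.ball (0 : ℂ) ρ := by
            rw [hz, mem_ball_zero_iff, norm_mul, Complex.norm_exp_ofReal_mul_I, mul_one,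
              Complex.norm_of_nonneg hr.1.le]
            exact hr.2
          rw [hg, Set.indicator_of_mem hm, hz, circleMap]
        simp only [he, smul_eq_mul]
        rw [lintegral_const_mul _ (by
          have := continuous_circleMap c r
          exact (hfc.comp this).enorm.measurable)]
        gcongr
        exact enorm_mul_two_pi_le_lintegral_circle hf c r
    _ ≤ _ := lintegral_mono_set Set.Ioo_subset_Ioi_self

/-- Fubini, with the Plancherel–Pólya inequality on each horizontal line. -/
theorem lintegral_strip_le {t : ℝ} (ht0 : 0 ≤ t) {f : ℂ → ℂ} (hf : Differentiable ℂ f)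
    (ht : HasExpTypeAtMost t f) (hi : Integrable (fun x : ℝ => f x)) {L : ℝ} :
    ∫⁻ z in {z : ℂ | |z.im| ≤ L}, ‖f z‖ₑ
      ≤ ENNReal.ofReal (2 * L * Real.exp (t * L)) * ∫⁻ x : ℝ, ‖f x‖ₑ := by
  have hfc := hf.continuous
  have hS : MeasurableSet {z : ℂ | |z.im| ≤ L} :=
    (isClosed_le (by fun_prop) continuous_const).measurableSet
  have hm : Measurable ({z : ℂ | |z.im| ≤ L}.indicator fun z => ‖f z‖ₑ) :=
    hfc.enorm.measurable.indicator hS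
  have hm' : Measurable fun p : ℝ × ℝ => {z : ℂ | |z.im| ≤ L}.indicator (fun z => ‖f z‖ₑ)
      (Complex.measurableEquivRealProd.symm p) :=
    hm.comp Complex.measurableEquivRealProd.symm.measurable
  rw [← lintegral_indicator hS, ← Complex.volume_preserving_equiv_real_prod.symm.lintegral_comp hm,
    Measure.volume_eq_prod, lintegral_prod_symm _ hm'.aemeasurable]
  calc _ ≤ ∫⁻ y : ℝ, (Set.Icc (-L) L).indicator (fun _ => ENNReal.ofReal (Real.exp (t * L)) * ∫⁻ x : ℝ, ‖f x‖ₑ) y := by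
        refine lintegral_mono fun y => ?_
        by_cases hy : y ∈ Set.Icc (-L) L
        · rw [Set.indicator_of_mem hy]
          have hyL : |y| ≤ L := abs_le.2 hy
          calc _ = ∫⁻ x : ℝ, ‖f (x + y * Complex.I)‖ₑ := by
                refine lintegral_congr fun x => ?_
                have h1 : Complex.measurableEquivRealProd.symm (x, y) = x + y * Complex.I := by
                  apply Complex.ext <;> simp
                rw [h1, Set.indicator_of_mem (by simpa using hyL)]
            _ ≤ _ := lintegral_enorm_horizontal_le hf ht hi y
            _ ≤ _ := by gcongr
        · rw [Set.indicator_of_notMem hy]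
          have hyL : ¬|y| ≤ L := fun h => hy (abs_le.1 h)
          refine le_of_eq ?_
          rw [lintegral_eq_zero_iff' (by
            have : Measurable fun x : ℝ => Complex.measurableEquivRealProd.symm (x, y) :=
              Complex.measurableEquivRealProd.symm.measurable.comp (by fun_prop)
            exact (hm.comp this).aemeasurable)]
          refine Eventually.of_forall fun x => ?_
          exact Set.indicator_of_notMem (by simpa using hyL) _
    _ = _ := by
        rw [lintegral_indicator measurableSet_Icc, setLIntegral_const, Real.volume_Icc,
          mul_right_comm, ← ENNReal.ofReal_mul (by positivity)]
        congr 2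
        ring

/-- `L¹`-control of the values at a separated set of points in a strip. -/
theorem sum_norm_le_of_separated {t : ℝ} (ht0 : 0 ≤ t) {H ρ : ℝ} (hH : 0 ≤ H) (hρ : 0 < ρ) :
    ∃ K : ℝ, 0 ≤ K ∧ ∀ f : ℂ → ℂ, Differentiable ℂ f → HasExpTypeAtMost t f →
      Integrable (fun x : ℝ => f x) → ∀ F : Finset ℂ, (∀ μ ∈ F, |μ.im| ≤ H) →
      (∀ μ ∈ F, ∀ ν ∈ F, μ ≠ ν → 2 * ρ ≤ ‖μ - ν‖) →
      ∑ μ ∈ F, ‖f μ‖ ≤ K * ∫ x : ℝ, ‖f x‖ := by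
  -- The constant of the strip of half-width H + ρ, which contains the disjoint discs of radius ρ
  -- about the points, divided by the area of one disc.
  refine ⟨2 * (H + ρ) * Real.exp (t * (H + ρ)) / (Real.pi * ρ ^ 2), by positivity,
    fun f hf ht hi F hF hsep => ?_⟩
  have hpos : 0 < Real.pi * ρ ^ 2 := by positivity
  have hint : 0 ≤ ∫ x : ℝ, ‖f x‖ := integral_nonneg fun _ => norm_nonneg _
  have hdisj : (F : Set ℂ).PairwiseDisjoint fun μ => Metric.ball μ ρ := by
    intro μ hμ ν hν hne
    refine Metric.ball_disjoint_ball ?_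
    rw [dist_eq_norm]
    linarith [hsep μ hμ ν hν hne]
  have h1 : ENNReal.ofReal (Real.pi * ρ ^ 2) * ∑ μ ∈ F, ‖f μ‖ₑ
      ≤ ENNReal.ofReal (2 * (H + ρ) * Real.exp (t * (H + ρ))) * ∫⁻ x : ℝ, ‖f x‖ₑ := by
    rw [Finset.mul_sum]
    calc _ ≤ ∑ μ ∈ F, ∫⁻ z in Metric.ball μ ρ, ‖f z‖ₑ :=
          Finset.sum_le_sum fun μ _ => enorm_mul_le_lintegral_ball hf μ hρ
      _ = ∫⁻ z in ⋃ μ ∈ F, Metric.ball μ ρ, ‖f z‖ₑ :=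
          (lintegral_biUnion_finset hdisj (fun _ _ => measurableSet_ball) _).symm
      _ ≤ ∫⁻ z in {z : ℂ | |z.im| ≤ H + ρ}, ‖f z‖ₑ := by
          refine lintegral_mono_set (Set.iUnion₂_subset fun μ hμ z hz => ?_)
          have h2 := (Complex.abs_im_le_norm (z - μ)).trans (mem_ball_iff_norm.1 hz).le
          have h3 : |z.im| ≤ |(z - μ).im| + |μ.im| := by
            rw [show z.im = (z - μ).im + μ.im by simp]; exact abs_add_le _ _
          exact h3.trans (by linarith [hF μ hμ])
      _ ≤ _ := lintegral_strip_le ht0 hf ht hi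
  rw [← ofReal_integral_norm_eq_lintegral_enorm hi] at h1
  have h4 : ∑ μ ∈ F, ‖f μ‖ₑ = ENNReal.ofReal (∑ μ ∈ F, ‖f μ‖) := by
    rw [ENNReal.ofReal_sum_of_nonneg fun _ _ => norm_nonneg _]
    simp only [ofReal_norm]
  rw [h4, ← ENNReal.ofReal_mul hpos.le, ← ENNReal.ofReal_mul (by positivity),
    ENNReal.ofReal_le_ofReal_iff (by positivity)] at h1
  rw [div_mul_eq_mul_div, le_div_iff₀ hpos]
  linarith

/-- A Paley–Wiener function is bounded by a multiple of `e^{t|Im z|}`. -/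
theorem exists_norm_le_exp_im {t : ℝ} (ht0 : 0 ≤ t) {f : ℂ → ℂ} (hf : Differentiable ℂ f)
    (ht : HasExpTypeAtMost t f) (hi : Integrable (fun x : ℝ => f x)) :
    ∃ M, 0 ≤ M ∧ ∀ z, ‖f z‖ ≤ M * Real.exp (t * |z.im|) := by
  obtain ⟨K, hK, h⟩ := sum_norm_le_of_separated ht0 le_rfl one_pos
  refine ⟨K * ∫ x : ℝ, ‖f x‖, mul_nonneg hK (integral_nonneg fun _ => norm_nonneg _),
    ht.norm_le hf fun x => ?_⟩
  have := h f hf ht hi {(x : ℂ)} (by simp) (by simp)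
  simpa using this

/-! ### Residues and the summation formula for decaying functions -/

theorem Differentiable.dslope {G : ℂ → ℂ} (hG : Differentiable ℂ G) (μ : ℂ) :
    Differentiable ℂ (dslope G μ) :=
  differentiableOn_univ.1 ((Complex.differentiableOn_dslope univ_mem).2 hG.differentiableOn)

/-- The residue theorem for `f G' / G` on a disc in which all zeros of `G` are simple. -/
theorem circleIntegral_mul_logDeriv {f : ℂ → ℂ} (hf : Differentiable ℂ f) {R : ℝ} (hR : 0 < R)
    (S : Finset ℂ) : ∀ G : ℂ → ℂ, Differentiable ℂ G → (∀ z ∈ Metric.closedBall 0 R, G z = 0 ↔ z ∈ S) →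
      (∀ μ ∈ S, μ ∈ Metric.ball 0 R) → (∀ μ ∈ S, deriv G μ ≠ 0) →
      (∮ z in C(0, R), f z * (deriv G z / G z)) = 2 * Real.pi * Complex.I * ∑ μ ∈ S, f μ := by
  induction S using Finset.induction_on with
  | empty =>
    intro G hG hz _ _
    have hne : ∀ z ∈ Metric.closedBall (0 : ℂ) R, G z ≠ 0 := fun z hzR h => by simpa using (hz z hzR).1 h
    have hd : ∀ z ∈ Metric.closedBall (0 : ℂ) R, DifferentiableAt ℂ (fun z => f z * (deriv G z / G z)) z :=
      fun z hzR => (hf z).mul ((hG.deriv z).div (hG z) (hne z hzR))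
    rw [Finset.sum_empty, mul_zero]
    exact Complex.circleIntegral_eq_zero_of_differentiable_on_off_countable hR.le Set.countable_empty
      (fun z hzR => (hd z hzR).continuousAt.continuousWithinAt)
      (fun z hzR => hd z (Metric.ball_subset_closedBall hzR.1))
  | insert μ S hμ ih =>
    intro G hG hz hball hsimple
    have hμR := hball μ (Finset.mem_insert_self _ _)
    have hGμ : G μ = 0 := (hz μ (Metric.ball_subset_closedBall hμR)).2 (Finset.mem_insert_self _ _)
    -- Dividing out the simple zero μ splits G'/G into 1/(z - μ) + G₁'/G₁. Cauchy's formula handles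
    -- the first term, induction the second.
    set G₁ := dslope G μ with hG₁
    have hG₁d : Differentiable ℂ G₁ := hG.dslope μ
    have hfac : ∀ z, G z = (z - μ) * G₁ z := fun z => by
      have := sub_smul_dslope G μ z
      rw [hGμ, sub_zero, smul_eq_mul] at this
      exact this.symm
    have hder : ∀ z, deriv G z = G₁ z + (z - μ) * deriv G₁ z := fun z => by
      have h1 : HasDerivAt (fun z => (z - μ) * G₁ z) (1 * G₁ z + (z - μ) * deriv G₁ z) z :=
        ((hasDerivAt_id z).sub_const μ).mul (hG₁d z).hasDerivAt
      rw [show G = fun z => (z - μ) * G₁ z from funext hfac, h1.deriv, one_mul]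
    have hz₁ : ∀ z ∈ Metric.closedBall (0 : ℂ) R, G₁ z = 0 ↔ z ∈ S := by
      intro z hzR
      rcases eq_or_ne z μ with rfl | hne
      · simp only [hμ, iff_false]
        rw [hG₁, dslope_same]
        exact hsimple _ (Finset.mem_insert_self _ _)
      · have := hz z hzR
        rw [hfac, mul_eq_zero, sub_eq_zero, Finset.mem_insert] at this
        simpa [hne] using this
    have hball₁ : ∀ ν ∈ S, ν ∈ Metric.ball (0 : ℂ) R := fun ν hν => hball ν (Finset.mem_insert_of_mem hν)
    have hI := ih G₁ hG₁d hz₁ hball₁ fun ν hν h0 => by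
      apply hsimple ν (Finset.mem_insert_of_mem hν)
      rw [hder, (hz₁ ν (Metric.ball_subset_closedBall (hball₁ ν hν))).2 hν, h0]
      simp
    have hsph : ∀ z ∈ Metric.sphere (0 : ℂ) R, z - μ ≠ 0 ∧ G₁ z ≠ 0 := by
      intro z hzR
      have hzn : z ∉ Metric.ball (0 : ℂ) R := by
        rw [mem_ball_zero_iff, mem_sphere_zero_iff_norm.1 hzR]; exact lt_irrefl _
      constructor
      · rw [sub_ne_zero]; rintro rfl; exact hzn hμR
      · intro h0
        exact hzn (hball₁ z ((hz₁ z (Metric.sphere_subset_closedBall hzR)).1 h0))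
    have hcau : (∮ z in C(0, R), (z - μ)⁻¹ • f z) = (2 * Real.pi * Complex.I : ℂ) • f μ :=
      hf.differentiableOn.circleIntegral_sub_inv_smul hμR
    have hfc := hf.continuous
    have hG₁c := hG₁d.continuous
    have hG₁c' := hG₁d.deriv.continuous
    rw [Finset.sum_insert hμ, mul_add, ← hI, ← smul_eq_mul (_ * _) (f μ), ← hcau,
      ← circleIntegral.integral_add]
    · refine circleIntegral.integral_congr hR.le fun z hzR => ?_
      obtain ⟨h1, h2⟩ := hsph z hzR
      simp only [smul_eq_mul]
      rw [hder, hfac]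
      field_simp
    · refine ContinuousOn.circleIntegrable hR.le fun z hzR => ContinuousAt.continuousWithinAt ?_
      exact ((continuousAt_id.sub continuousAt_const).inv₀ (hsph z hzR).1).smul hfc.continuousAt
    · refine ContinuousOn.circleIntegrable hR.le fun z hzR => ContinuousAt.continuousWithinAt ?_
      exact hfc.continuousAt.mul (hG₁c'.continuousAt.div hG₁c.continuousAt (hsph z hzR).2)

/-- The zero sum over a disc as a boundary integral, for functions satisfying the Wronskian
identity. -/
theorem sum_zeros_sub_eq_circleIntegral {a : ℂ} {G : ℂ → ℂ} (hG : Differentiable ℂ G)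
    (hW : ∀ z, a * G z * G (-z) - z ^ 2 * (deriv G z * G (-z) + G z * deriv G (-z)) = a * G 0 ^ 2)
    (ha : a * G 0 ^ 2 ≠ 0) {f : ℂ → ℂ} (hf : Differentiable ℂ f) {R : ℝ} (hR : 0 < R) (S : Finset ℂ)
    (hz : ∀ z ∈ Metric.closedBall 0 R, G z = 0 ↔ z ∈ S) (hball : ∀ μ ∈ S, μ ∈ Metric.ball 0 R) :
    a * deriv f 0 - ∑ μ ∈ S, (f μ - f (-μ))
      = (2 * Real.pi * Complex.I : ℂ)⁻¹ • ∮ z in C(0, R), a * G 0 ^ 2 * f z / (z ^ 2 * (G z * G (-z))) := by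
  have hsimple : ∀ μ, G μ = 0 → deriv G μ ≠ 0 := by
    intro μ h0 h1
    apply ha
    rw [← hW μ, h0, h1]; simp
  have hsph : ∀ z ∈ Metric.sphere (0 : ℂ) R, z ≠ 0 ∧ G z ≠ 0 ∧ G (-z) ≠ 0 := by
    have key : ∀ z ∈ Metric.sphere (0 : ℂ) R, G z ≠ 0 := by
      intro z hzR h0
      have := hball z ((hz z (Metric.sphere_subset_closedBall hzR)).1 h0)
      rw [mem_ball_zero_iff, mem_sphere_zero_iff_norm.1 hzR] at this
      exact lt_irrefl _ this
    intro z hzR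
    refine ⟨?_, key z hzR, key (-z) (by simpa using hzR)⟩
    rintro rfl
    rw [mem_sphere_zero_iff_norm, norm_zero] at hzR
    exact hR.ne hzR
  have hGm : Differentiable ℂ fun z => G (-z) := hG.comp differentiable_neg
  have hdm : deriv (fun z => G (-z)) = fun z => -deriv G (-z) := deriv_comp_neg' G
  have I1 := circleIntegral_mul_logDeriv hf hR S G hG hz hball fun μ hμ =>
    hsimple μ ((hz μ (Metric.ball_subset_closedBall (hball μ hμ))).2 hμ)
  have I2 := circleIntegral_mul_logDeriv hf hR (S.map (Equiv.neg ℂ).toEmbedding) (fun z => G (-z)) hGm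
    (fun z hzR => by
      rw [hz (-z) (by simpa using hzR)]
      simp)
    (fun μ hμ => by
      obtain ⟨ν, hν, rfl⟩ := Finset.mem_map.1 hμ
      simpa using hball ν hν)
    (fun μ hμ => by
      obtain ⟨ν, hν, rfl⟩ := Finset.mem_map.1 hμ
      rw [hdm]
      simpa using hsimple ν ((hz ν (Metric.ball_subset_closedBall (hball ν hν))).2 hν))
  rw [Finset.sum_map] at I2
  have I3 : (2 * Real.pi * Complex.I : ℂ)⁻¹ • (∮ z in C(0, R), ((z - 0) ^ 2)⁻¹ • f z) = deriv f 0 :=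
    Complex.two_pi_I_inv_smul_circleIntegral_sub_sq_inv_smul_of_differentiable isOpen_univ
      (Set.subset_univ _) hf.differentiableOn (Metric.mem_ball_self hR)
  have hfc := hf.continuous
  have hGc := hG.continuous
  have hGc' := hG.deriv.continuous
  have c1 : CircleIntegrable (fun z => a * (((z - 0) ^ 2)⁻¹ • f z)) 0 R := by
    refine ContinuousOn.circleIntegrable hR.le fun z hzR => ContinuousAt.continuousWithinAt ?_
    have h0 : (z - 0) ^ 2 ≠ 0 := by simpa using (hsph z hzR).1
    fun_prop (disch := assumption)
  have c2 : CircleIntegrable (fun z => f z * (deriv G z / G z)) 0 R := by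
    refine ContinuousOn.circleIntegrable hR.le fun z hzR => ContinuousAt.continuousWithinAt ?_
    have h0 := (hsph z hzR).2.1
    fun_prop (disch := assumption)
  have c3 : CircleIntegrable (fun z => f z * (deriv (fun z => G (-z)) z / G (-z))) 0 R := by
    rw [hdm]
    refine ContinuousOn.circleIntegrable hR.le fun z hzR => ContinuousAt.continuousWithinAt ?_
    have h0 := (hsph z hzR).2.2
    fun_prop (disch := assumption)
  have c12 : CircleIntegrable (fun z => a * (((z - 0) ^ 2)⁻¹ • f z) - f z * (deriv G z / G z)) 0 R :=
    c1.sub c2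
  have hpi : (2 * Real.pi * Complex.I : ℂ) ≠ 0 := Complex.two_pi_I_ne_zero
  -- The Wronskian identity divided by z² G(z)G(-z). The last two terms are f times the logarithmic
  -- derivatives of G(z) and of G(-z).
  have hsplit : (∮ z in C(0, R), a * G 0 ^ 2 * f z / (z ^ 2 * (G z * G (-z))))
      = (∮ z in C(0, R), a * (((z - 0) ^ 2)⁻¹ • f z)) - (∮ z in C(0, R), f z * (deriv G z / G z))
        + ∮ z in C(0, R), f z * (deriv (fun z => G (-z)) z / G (-z)) := by
    rw [← circleIntegral.integral_sub c1 c2, ← circleIntegral.integral_add c12 c3]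
    refine circleIntegral.integral_congr hR.le fun z hzR => ?_
    obtain ⟨h1, h2, h3⟩ := hsph z hzR
    simp only [hdm, smul_eq_mul, sub_zero]
    rw [← hW z]
    field_simp
    ring
  rw [hsplit, I1, I2, circleIntegral.integral_const_mul, smul_add, smul_sub, smul_eq_mul, mul_left_comm,
    ← smul_eq_mul _ (∮ z in C(0, R), ((z - 0) ^ 2)⁻¹ • f z), I3, smul_eq_mul, smul_eq_mul,
    inv_mul_cancel_left₀ hpi, inv_mul_cancel_left₀ hpi, Finset.sum_sub_distrib]
  simp only [Equiv.coe_toEmbedding, Equiv.neg_apply]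
  ring

/-- The zeros of a nonzero entire function in a closed disc form a finite set. -/
theorem finite_zeros_closedBall {G : ℂ → ℂ} (hG : Differentiable ℂ G) (h0 : G 0 ≠ 0) (r : ℝ) :
    {z : ℂ | G z = 0 ∧ ‖z‖ ≤ r}.Finite := by
  by_contra hinf
  obtain ⟨z, -, hz⟩ := Set.Infinite.exists_accPt_of_subset_isCompact hinf (isCompact_closedBall (0 : ℂ) r)
    fun z hz => by simpa using hz.2
  rw [accPt_iff_frequently_nhdsNE] at hz
  have hGa : AnalyticOnNhd ℂ G Set.univ := Complex.analyticOnNhd_univ_iff_differentiable.2 hG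
  exact h0 (hGa.eqOn_zero_of_preconnected_of_frequently_eq_zero isPreconnected_univ (Set.mem_univ z)
    (hz.mono fun w hw => hw.1) (Set.mem_univ 0))

/-- The finite set of zeros in the closed disc of radius `r`. -/
noncomputable def zerosIn {G : ℂ → ℂ} (hG : Differentiable ℂ G) (h0 : G 0 ≠ 0) (r : ℝ) :
    Finset {w : ℂ // G w = 0} :=
  ((finite_zeros_closedBall hG h0 r).preimage (f := (Subtype.val : {w : ℂ // G w = 0} → ℂ))
    Subtype.val_injective.injOn).toFinset

theorem mem_zerosIn {G : ℂ → ℂ} (hG : Differentiable ℂ G) (h0 : G 0 ≠ 0) (r : ℝ)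
    (μ : {w : ℂ // G w = 0}) : μ ∈ zerosIn hG h0 r ↔ ‖(μ : ℂ)‖ ≤ r := by
  simp [zerosIn, μ.2]

theorem tendsto_zerosIn {G : ℂ → ℂ} (hG : Differentiable ℂ G) (h0 : G 0 ≠ 0) {R : ℕ → ℝ}
    (hR : Tendsto R atTop atTop) : Tendsto (fun n => zerosIn hG h0 (R n)) atTop atTop := by
  refine tendsto_atTop.2 fun t => ?_
  filter_upwards [hR.eventually_ge_atTop (∑ μ ∈ t, ‖(μ : ℂ)‖)] with n hn μ hμ
  rw [mem_zerosIn]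
  exact (Finset.single_le_sum (f := fun μ : {w : ℂ // G w = 0} => ‖(μ : ℂ)‖)
    (fun _ _ => norm_nonneg _) hμ).trans hn

/-- The summation formula along a sequence of discs, for functions decaying like
`|z|⁻² e^{π |Im z|}`. -/
theorem tendsto_sum_zerosIn {a : ℂ} {G : ℂ → ℂ} (hG : Differentiable ℂ G) (h0 : G 0 ≠ 0) (ha : a ≠ 0)
    (hW : ∀ z, a * G z * G (-z) - z ^ 2 * (deriv G z * G (-z) + G z * deriv G (-z)) = a * G 0 ^ 2)
    {R : ℕ → ℝ} {c : ℝ} (hR : Tendsto R atTop atTop) (hc : 0 < c)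
    (hlow : ∀ᶠ n in atTop, ∀ z : ℂ, ‖z‖ = R n → c * Real.exp (Real.pi / 2 * |z.im|) ≤ ‖z * G z‖)
    {f : ℂ → ℂ} (hf : Differentiable ℂ f) {M : ℝ}
    (hM : ∀ z, ‖f z‖ * ‖z‖ ^ 2 ≤ M * Real.exp (Real.pi * |z.im|)) :
    Tendsto (fun n => ∑ μ ∈ zerosIn hG h0 (R n), (f μ - f (-μ))) atTop (𝓝 (a * deriv f 0)) := by
  have hM0 : 0 ≤ M := by
    have := (by positivity : (0 : ℝ) ≤ _).trans (hM 0)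
    simpa using this
  have haG : a * G 0 ^ 2 ≠ 0 := mul_ne_zero ha (pow_ne_zero 2 h0)
  rw [tendsto_iff_norm_sub_tendsto_zero]
  have hlim : Tendsto (fun n => ‖a * G 0 ^ 2‖ * M / c ^ 2 * (R n)⁻¹) atTop (𝓝 0) := by
    have := (tendsto_inv_atTop_zero.comp hR).const_mul (‖a * G 0 ^ 2‖ * M / c ^ 2)
    rwa [mul_zero] at this
  refine squeeze_zero' (Eventually.of_forall fun _ => norm_nonneg _) ?_ hlim
  filter_upwards [hlow, hR.eventually_gt_atTop 0] with n hn hRn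
  have hsph : ∀ z : ℂ, ‖z‖ = R n → G z ≠ 0 := by
    intro z hz h
    have h1 := hn z hz
    rw [h, mul_zero, norm_zero] at h1
    exact absurd h1 (not_le.2 (by positivity))
  have hmem : ∀ z, z ∈ (zerosIn hG h0 (R n)).map (Function.Embedding.subtype _) ↔ G z = 0 ∧ ‖z‖ ≤ R n := by
    intro z
    simp only [Finset.mem_map, mem_zerosIn, Function.Embedding.subtype_apply, Subtype.exists,
      exists_and_left, exists_prop]
    constructor
    · rintro ⟨w, hw1, hw2, rfl⟩; exact ⟨hw2, hw1⟩
    · rintro ⟨h1, h2⟩; exact ⟨z, h2, h1, rfl⟩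
  have key := sum_zeros_sub_eq_circleIntegral hG hW haG hf hRn
    ((zerosIn hG h0 (R n)).map (Function.Embedding.subtype _))
    (fun z hz => by
      rw [hmem]
      exact ⟨fun h => ⟨h, by simpa using hz⟩, fun h => h.1⟩)
    (fun μ hμ => by
      obtain ⟨h1, h2⟩ := (hmem μ).1 hμ
      rw [mem_ball_zero_iff]
      exact lt_of_le_of_ne h2 fun h => hsph μ h h1)
  rw [Finset.sum_map] at key
  simp only [Function.Embedding.subtype_apply] at key
  rw [norm_sub_rev, key]
  -- The exponentials in f and in z² G(z)G(-z) cancel, so the integrand is O(R⁻²) on a circle of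
  -- length 2πR.
  refine (circleIntegral.norm_two_pi_i_inv_smul_integral_le_of_norm_le_const hRn.le
    (C := ‖a * G 0 ^ 2‖ * M / c ^ 2 / R n ^ 2) fun z hz => ?_).trans (le_of_eq ?_)
  · have hzn : ‖z‖ = R n := mem_sphere_zero_iff_norm.1 hz
    have h1 := hn z hzn
    have h2 := hn (-z) (by rwa [norm_neg])
    rw [Complex.neg_im, abs_neg] at h2
    have h3 : c ^ 2 * Real.exp (Real.pi * |z.im|) ≤ ‖z ^ 2 * (G z * G (-z))‖ := by
      calc c ^ 2 * Real.exp (Real.pi * |z.im|)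
          = (c * Real.exp (Real.pi / 2 * |z.im|)) * (c * Real.exp (Real.pi / 2 * |z.im|)) := by
            rw [show Real.pi * |z.im| = Real.pi / 2 * |z.im| + Real.pi / 2 * |z.im| by ring, Real.exp_add]
            ring
        _ ≤ ‖z * G z‖ * ‖-z * G (-z)‖ := by gcongr
        _ = _ := by
          rw [← norm_mul, ← norm_neg]
          congr 1; ring
    have h4 : ‖f z‖ ≤ M * Real.exp (Real.pi * |z.im|) / R n ^ 2 := by
      rw [le_div_iff₀ (by positivity), ← hzn]; exact hM z
    rw [norm_div, norm_mul]
    calc _ ≤ ‖a * G 0 ^ 2‖ * (M * Real.exp (Real.pi * |z.im|) / R n ^ 2)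
          / (c ^ 2 * Real.exp (Real.pi * |z.im|)) := by gcongr
      _ = _ := by field_simp
  · field_simp

/-! ### Approximation of Paley–Wiener functions -/

theorem norm_exp_mul_I_le (w : ℂ) : ‖Complex.exp (w * Complex.I)‖ ≤ Real.exp |w.im| := by
  rw [Complex.norm_exp]
  gcongr
  simpa using neg_le_abs w.im

theorem Complex.norm_sin_le_exp_abs_im (w : ℂ) : ‖Complex.sin w‖ ≤ Real.exp |w.im| := by
  have h1 := norm_exp_mul_I_le w
  have h2 := norm_exp_mul_I_le (-w)
  rw [Complex.neg_im, abs_neg] at h2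
  rw [Complex.sin, norm_div, norm_mul, Complex.norm_I, mul_one, Complex.norm_two, div_le_iff₀ two_pos]
  exact (norm_sub_le _ _).trans (by linarith)

theorem Complex.norm_cos_le_exp_abs_im (w : ℂ) : ‖Complex.cos w‖ ≤ Real.exp |w.im| := by
  have h1 := norm_exp_mul_I_le w
  have h2 := norm_exp_mul_I_le (-w)
  rw [Complex.neg_im, abs_neg] at h2
  rw [Complex.cos, norm_div, Complex.norm_two, div_le_iff₀ two_pos]
  exact (norm_add_le _ _).trans (by linarith)

theorem Complex.norm_sin_le_exp_abs_im_mul_norm (w : ℂ) : ‖Complex.sin w‖ ≤ Real.exp |w.im| * ‖w‖ := by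
  have := (convex_segment (𝕜 := ℝ) (0 : ℂ) w).norm_image_sub_le_of_norm_hasDerivWithin_le
    (f := Complex.sin) (f' := Complex.cos) (C := Real.exp |w.im|)
    (fun z _ => (Complex.hasDerivAt_sin z).hasDerivWithinAt) (fun z hz => ?_)
    (left_mem_segment _ _ _) (right_mem_segment _ _ _)
  · simpa using this
  · refine (Complex.norm_cos_le_exp_abs_im z).trans ?_
    obtain ⟨α, β, hα, hβ, hαβ, rfl⟩ := hz
    refine Real.exp_le_exp.2 ?_
    have him : (α • (0 : ℂ) + β • w).im = β * w.im := by simp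
    rw [him, abs_mul, abs_of_nonneg hβ]
    exact mul_le_of_le_one_left (abs_nonneg _) (by linarith)

/-- The entire function `sin z / z`. -/
noncomputable def entireSinc : ℂ → ℂ := dslope Complex.sin 0

theorem differentiable_entireSinc : Differentiable ℂ entireSinc := Complex.differentiable_sin.dslope 0

theorem entireSinc_zero : entireSinc 0 = 1 := by
  simp [entireSinc, dslope_same]

theorem mul_entireSinc (w : ℂ) : w * entireSinc w = Complex.sin w := by
  have := sub_smul_dslope Complex.sin 0 w
  simpa [entireSinc] using this

theorem norm_mul_norm_entireSinc_le (w : ℂ) : ‖w‖ * ‖entireSinc w‖ ≤ Real.exp |w.im| := by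
  rw [← norm_mul, mul_entireSinc]; exact Complex.norm_sin_le_exp_abs_im w

theorem norm_entireSinc_le (w : ℂ) : ‖entireSinc w‖ ≤ Real.exp |w.im| := by
  rcases eq_or_ne w 0 with rfl | hw
  · simp [entireSinc_zero]
  · refine le_of_mul_le_mul_left ?_ (norm_pos_iff.2 hw)
    rw [← norm_mul, mul_entireSinc, mul_comm]
    exact Complex.norm_sin_le_exp_abs_im_mul_norm w

/-- A bounded-by-dilation form of Scheffé's lemma. -/
theorem tendsto_integral_norm_sub {g : ℝ → ℂ} (hg : Integrable g) {F : ℕ → ℝ → ℂ}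
    (hF : ∀ n, Integrable (F n)) (hlim : ∀ x, Tendsto (fun n => F n x) atTop (𝓝 (g x))) {κ : ℕ → ℝ}
    (hκ : Tendsto κ atTop (𝓝 1)) (hle : ∀ n, ∫ x, ‖F n x‖ ≤ κ n * ∫ x, ‖g x‖) :
    Tendsto (fun n => ∫ x, ‖F n x - g x‖) atTop (𝓝 0) := by
  have hint : ∀ n, Integrable fun x => ‖F n x - g x‖ - ‖F n x‖ + ‖g x‖ := fun n =>
    ((((hF n).sub hg).norm.sub (hF n).norm).add hg.norm)
  -- The integrand lies between 0 and 2‖g‖ and tends to 0 pointwise, so no dominating function for F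
  -- is needed.
  have hdct : Tendsto (fun n => ∫ x, (‖F n x - g x‖ - ‖F n x‖ + ‖g x‖)) atTop (𝓝 (∫ _x : ℝ, (0 : ℝ))) := by
    refine tendsto_integral_of_dominated_convergence (fun x => 2 * ‖g x‖)
      (fun n => (hint n).aestronglyMeasurable) (hg.norm.const_mul 2) (fun n => ?_) ?_
    · filter_upwards with x
      rw [Real.norm_eq_abs, abs_le]
      have h1 := norm_sub_norm_le (F n x) (g x)
      have h2 := norm_sub_le (F n x) (g x)
      have h3 := norm_nonneg (g x)
      constructor <;> linarith
    · filter_upwards with x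
      have := (((hlim x).sub_const (g x)).norm.sub (hlim x).norm).add_const ‖g x‖
      simpa using this
  have hsum : ∀ n, ∫ x, ‖F n x - g x‖
      ≤ (∫ x, (‖F n x - g x‖ - ‖F n x‖ + ‖g x‖)) + (κ n - 1) * ∫ x, ‖g x‖ := by
    intro n
    have i1 : Integrable fun x => ‖F n x - g x‖ := ((hF n).sub hg).norm
    have : ∫ x, (‖F n x - g x‖ - ‖F n x‖ + ‖g x‖)
        = (∫ x, ‖F n x - g x‖) - (∫ x, ‖F n x‖) + ∫ x, ‖g x‖ := by
      have i2 : Integrable fun x => ‖F n x - g x‖ - ‖F n x‖ := i1.sub (hF n).norm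
      rw [integral_add i2 hg.norm, integral_sub i1 (hF n).norm]
    rw [this]
    linarith [hle n]
  have h0 : Tendsto (fun n => (∫ x, (‖F n x - g x‖ - ‖F n x‖ + ‖g x‖)) + (κ n - 1) * ∫ x, ‖g x‖) atTop
      (𝓝 0) := by
    simpa using hdct.add ((hκ.sub_const 1).mul_const (∫ x, ‖g x‖))
  exact squeeze_zero (fun n => integral_nonneg fun _ => norm_nonneg _) hsum h0

/-- Paley–Wiener functions are approximated in `PW¹` by functions with additional decay. -/
theorem IsPW1.exists_approx {f : ℂ → ℂ} (hf : IsPW1 f) :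
    ∃ F : ℕ → ℂ → ℂ, (∀ n, IsPW1 (F n)) ∧
      (∀ n, ∃ M, ∀ z, ‖F n z‖ * ‖z‖ ^ 2 ≤ M * Real.exp (Real.pi * |z.im|)) ∧
      Tendsto (fun n => ∫ x : ℝ, ‖F n x - f x‖) atTop (𝓝 0) ∧
      Tendsto (fun n => deriv (F n) 0) atTop (𝓝 (deriv f 0)) := by
  obtain ⟨hfd, hft, hfi⟩ := hf
  obtain ⟨M, hM0, hM⟩ := exists_norm_le_exp_im Real.pi_pos.le hfd hft hfi
  set δ : ℕ → ℝ := fun n => 1 / ((n : ℝ) + 2) with hδ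
  have hδ0 : ∀ n, 0 < δ n := fun n => by simp only [hδ]; positivity
  have hδ1 : ∀ n, δ n < 1 := fun n => by
    simp only [hδ]; rw [div_lt_one (by positivity)]; linarith [n.cast_nonneg (α := ℝ)]
  have hδlim : Tendsto δ atTop (𝓝 0) :=
    tendsto_const_nhds.div_atTop (tendsto_atTop_add_const_right _ _ tendsto_natCast_atTop_atTop)
  -- Dilation lowers the type to π(1 - δ). The spare πδ is spent on two sinc factors of type πδ/2,
  -- which supply the decay |z|⁻².
  set F : ℕ → ℂ → ℂ := fun n z =>
    f ((1 - δ n : ℝ) * z) * entireSinc ((Real.pi * δ n / 2 : ℝ) * z) ^ 2 with hF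
  have hsd := differentiable_entireSinc
  have hFd : ∀ n, Differentiable ℂ (F n) := fun n => by
    simp only [hF]
    exact (hfd.comp (differentiable_id.const_mul _)).mul ((hsd.comp (differentiable_id.const_mul _)).pow 2)
  have h1 : ∀ n z, ‖f ((1 - δ n : ℝ) * z)‖ ≤ M * Real.exp (Real.pi * (1 - δ n) * |z.im|) := fun n z => by
    have := hM ((1 - δ n : ℝ) * z)
    rwa [Complex.im_ofReal_mul, abs_mul, abs_of_pos (by linarith [hδ1 n]), ← mul_assoc] at this
  have hσ : ∀ n, 0 < Real.pi * δ n / 2 := fun n => by have := hδ0 n; positivity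
  have h2 : ∀ n z, ‖entireSinc ((Real.pi * δ n / 2 : ℝ) * z)‖ ≤ Real.exp (Real.pi * δ n / 2 * |z.im|) := fun n z => by
    have := norm_entireSinc_le ((Real.pi * δ n / 2 : ℝ) * z)
    rwa [Complex.im_ofReal_mul, abs_mul, abs_of_pos (hσ n)] at this
  have h3 : ∀ n z, ‖z‖ * ‖entireSinc ((Real.pi * δ n / 2 : ℝ) * z)‖
      ≤ Real.exp (Real.pi * δ n / 2 * |z.im|) / (Real.pi * δ n / 2) := fun n z => by
    have := norm_mul_norm_entireSinc_le ((Real.pi * δ n / 2 : ℝ) * z)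
    rw [Complex.im_ofReal_mul, abs_mul, abs_of_pos (hσ n), norm_mul, Complex.norm_real, Real.norm_eq_abs,
      abs_of_pos (hσ n)] at this
    rw [le_div_iff₀ (hσ n)]
    linarith
  have hexp : ∀ n (y : ℝ), Real.exp (Real.pi * (1 - δ n) * y) * Real.exp (Real.pi * δ n / 2 * y) ^ 2
      = Real.exp (Real.pi * y) := fun n y => by
    rw [← Real.exp_nat_mul, ← Real.exp_add]; congr 1; push_cast; ring
  have hFle : ∀ n z, ‖F n z‖ ≤ M * Real.exp (Real.pi * |z.im|) := fun n z => by
    simp only [hF]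
    rw [norm_mul, norm_pow]
    calc _ ≤ M * Real.exp (Real.pi * (1 - δ n) * |z.im|) * Real.exp (Real.pi * δ n / 2 * |z.im|) ^ 2 := by
          gcongr
          · exact h1 n z
          · exact h2 n z
      _ = _ := by rw [mul_assoc, hexp]
  have hdil : ∀ n, Integrable fun x : ℝ => f ((1 - δ n : ℝ) * x) := fun n => by
    have := hfi.comp_mul_left' (R := 1 - δ n) (by linarith [hδ1 n])
    simpa using this
  have hFx : ∀ n (x : ℝ), ‖F n x‖ ≤ ‖f ((1 - δ n : ℝ) * x)‖ := fun n x => by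
    simp only [hF]
    rw [norm_mul, norm_pow]
    refine mul_le_of_le_one_right (norm_nonneg _) (pow_le_one₀ (norm_nonneg _) ?_)
    simpa using h2 n x
  have hFi : ∀ n, Integrable fun x : ℝ => F n x := fun n => by
    refine (hdil n).mono ?_ (Eventually.of_forall (hFx n))
    exact ((hFd n).continuous.comp Complex.continuous_ofReal).aestronglyMeasurable
  refine ⟨F, fun n => ⟨hFd n, fun ε hε => ⟨M, fun z => (hFle n z).trans ?_⟩, hFi n⟩, fun n => ?_, ?_, ?_⟩
  · gcongr
    · linarith
    · exact Complex.abs_im_le_norm z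
  · refine ⟨M / (Real.pi * δ n / 2) ^ 2, fun z => ?_⟩
    simp only [hF]
    rw [norm_mul, norm_pow]
    calc _ = ‖f ((1 - δ n : ℝ) * z)‖ * (‖z‖ * ‖entireSinc ((Real.pi * δ n / 2 : ℝ) * z)‖) ^ 2 := by ring
      _ ≤ M * Real.exp (Real.pi * (1 - δ n) * |z.im|)
          * (Real.exp (Real.pi * δ n / 2 * |z.im|) / (Real.pi * δ n / 2)) ^ 2 := by
          gcongr
          · exact h1 n z
          · exact h3 n z
      _ = _ := by rw [← hexp n]; ring
  · have hκ : Tendsto (fun n => (1 - δ n)⁻¹) atTop (𝓝 1) := by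
      simpa using (hδlim.const_sub 1).inv₀ (by norm_num)
    refine tendsto_integral_norm_sub hfi hFi (fun x => ?_) hκ fun n => ?_
    · have hc : Continuous fun d : ℝ => f ((1 - d : ℝ) * x) * entireSinc ((Real.pi * d / 2 : ℝ) * x) ^ 2 := by
        have := hfd.continuous
        have := hsd.continuous
        fun_prop
      have := (hc.tendsto 0).comp hδlim
      simpa [entireSinc_zero, hF, Function.comp_def] using this
    · calc ∫ x : ℝ, ‖F n x‖ ≤ ∫ x : ℝ, ‖f ((1 - δ n : ℝ) * x)‖ :=
            integral_mono (hFi n).norm (hdil n).norm (hFx n)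
        _ = _ := by
            have := Measure.integral_comp_mul_left (fun x : ℝ => ‖f x‖) (1 - δ n)
            rw [abs_of_pos (inv_pos.2 (by linarith [hδ1 n])), smul_eq_mul] at this
            rw [← this]
            simp
  · have hder : ∀ n, deriv (F n) 0 = deriv f 0 * (1 - δ n : ℝ)
        + f 0 * (2 * (deriv entireSinc 0 * (Real.pi * δ n / 2 : ℝ))) := by
      intro n
      have d1 : HasDerivAt (fun z : ℂ => f ((1 - δ n : ℝ) * z)) (deriv f 0 * ((1 - δ n : ℝ) * 1)) 0 := by
        refine HasDerivAt.comp (h₂ := f) 0 ?_ ((hasDerivAt_id (0 : ℂ)).const_mul _)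
        simpa using (hfd 0).hasDerivAt
      have d2 : HasDerivAt (fun z : ℂ => entireSinc ((Real.pi * δ n / 2 : ℝ) * z))
          (deriv entireSinc 0 * ((Real.pi * δ n / 2 : ℝ) * 1)) 0 := by
        refine HasDerivAt.comp (h₂ := entireSinc) 0 ?_ ((hasDerivAt_id (0 : ℂ)).const_mul _)
        simpa using (hsd 0).hasDerivAt
      refine ((d1.mul (d2.pow 2)).congr_deriv ?_).deriv
      simp [entireSinc_zero]
    simp only [hder]
    have hc : Continuous fun d : ℝ => deriv f 0 * (1 - d : ℝ)
        + f 0 * (2 * (deriv entireSinc 0 * (Real.pi * d / 2 : ℝ))) := by fun_prop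
    have := (hc.tendsto 0).comp hδlim
    simpa [Function.comp_def] using this

/-! ### Separation of zeros and absolute convergence -/

/-- Two zeros of `u` in a strip cannot be close unless the derivative is small there. -/
theorem norm_deriv_le_of_zeros_in_strip {u : ℂ → ℂ} (hu : Differentiable ℂ u) {H B : ℝ}
    (hB : ∀ z : ℂ, |z.im| ≤ H + 1 → ‖deriv u z‖ ≤ B) {μ ν : ℂ} (hμ : |μ.im| ≤ H) (hν : |ν.im| ≤ H)
    (hμ0 : u μ = 0) (hν0 : u ν = 0) (hne : μ ≠ ν) : ‖deriv u μ‖ ≤ B * ‖ν - μ‖ := by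
  have hstrip : ∀ z ∈ segment ℝ μ ν, |z.im| ≤ H := by
    intro z hz
    have hcvx : Convex ℝ {z : ℂ | |z.im| ≤ H} := by
      have : {z : ℂ | |z.im| ≤ H} = Complex.imLm ⁻¹' Set.Icc (-H) H := by
        ext z
        simp [abs_le]
      rw [this]
      exact (convex_Icc (-H) H).linear_preimage _
    exact hcvx.segment_subset hμ hν hz
  have hB2 : ∀ z : ℂ, |z.im| ≤ H → ‖deriv (deriv u) z‖ ≤ B := by
    intro z hz
    have := Complex.norm_deriv_le_of_forall_mem_sphere_norm_le (f := deriv u) (c := z) one_pos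
      hu.deriv.diffContOnCl (C := B) fun x hx => hB x ?_
    · simpa using this
    · rw [mem_sphere_iff_norm] at hx
      have h1 : |(x - z).im| ≤ 1 := hx ▸ Complex.abs_im_le_norm _
      rw [Complex.sub_im] at h1
      have := abs_add_le (x.im - z.im) z.im
      rw [sub_add_cancel] at this
      linarith
  have h1 : ∀ z ∈ segment ℝ μ ν, ‖deriv u z - deriv u μ‖ ≤ B * ‖ν - μ‖ := by
    intro z hz
    refine ((convex_segment μ ν).norm_image_sub_le_of_norm_deriv_le
      (fun x _ => hu.deriv x) (fun x hx => hB2 x (hstrip x hx)) (left_mem_segment ℝ μ ν) hz).trans ?_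
    refine mul_le_mul_of_nonneg_left (norm_sub_le_of_mem_segment hz) ?_
    exact (norm_nonneg _).trans (hB2 μ hμ)
  -- Subtracting the linear part at μ leaves a function whose derivative is at most B‖ν - μ‖ on the
  -- segment. Its increment between the zeros is -u'(μ)(ν - μ), and one factor of |ν - μ| cancels.
  have h2 := (convex_segment μ ν).norm_image_sub_le_of_norm_hasDerivWithin_le
    (f := fun z => u z - deriv u μ * z) (f' := fun z => deriv u z - deriv u μ)
    (fun x _ => ((hu x).hasDerivAt.sub (by
      simpa using (hasDerivAt_id x).const_mul (deriv u μ))).hasDerivWithinAt)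
    h1 (left_mem_segment ℝ μ ν) (right_mem_segment ℝ μ ν)
  rw [hμ0, hν0, show (0 - deriv u μ * ν - (0 - deriv u μ * μ)) = -(deriv u μ * (ν - μ)) by ring,
    norm_neg, norm_mul] at h2
  exact le_of_mul_le_mul_right h2 (norm_pos_iff.2 (sub_ne_zero.2 hne.symm))

/-- Nonzero zeros of `u` in a strip are uniformly separated. -/
theorem IsModifiedSolution.exists_separation {a ev : ℂ} {b : ℝ} {u : ℂ → ℂ}
    (h : IsModifiedSolution a ev b u) (hb : 0 < b) {w : ℂ} (hw0 : w ≠ 0)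
    (hw : ∀ z ≠ 0, deriv u z * u (-z) + u z * deriv u (-z) - a / z ^ 2 * (u z * u (-z)) = w)
    {H : ℝ} :
    ∃ ρ : ℝ, 0 < ρ ∧ ∀ μ ν : ℂ, μ ≠ 0 → u μ = 0 → u ν = 0 → |μ.im| ≤ H → |ν.im| ≤ H → μ ≠ ν →
      2 * ρ ≤ ‖μ - ν‖ := by
  obtain ⟨C, hC0, hC⟩ := h.exists_upper_bound hb
  set B : ℝ := C * Real.exp (b * (H + 1)) + 1 with hBdef
  have hB : 0 < B := by positivity
  have hle : ∀ z : ℂ, |z.im| ≤ H + 1 → C * Real.exp (b * |z.im|) ≤ B := by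
    intro z hz
    have : C * Real.exp (b * |z.im|) ≤ C * Real.exp (b * (H + 1)) := by gcongr
    linarith
  have hw' : 0 < ‖w‖ := norm_pos_iff.2 hw0
  refine ⟨‖w‖ / (2 * B ^ 2), by positivity, fun μ ν hμ0 hμ hν hμH hνH hne => ?_⟩
  have h1 := norm_deriv_le_of_zeros_in_strip h.differentiable
    (fun z hz => (hC z).2.trans (hle z hz)) hμH hνH hμ hν hne
  -- At a zero the identity reads u'(μ)u(-μ) = w. As u(-μ) is bounded on the strip, u'(μ) is bounded
  -- below.
  have h2 := hw μ hμ0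
  rw [hμ] at h2
  simp only [zero_mul, mul_zero, add_zero, sub_zero] at h2
  have h3 : ‖u (-μ)‖ ≤ B := (hC (-μ)).1.trans (hle _ (by simp; linarith))
  have h4 : ‖w‖ ≤ B * ‖ν - μ‖ * B := by
    rw [← h2, norm_mul]
    gcongr
  rw [norm_sub_rev, show 2 * (‖w‖ / (2 * B ^ 2)) = ‖w‖ / B ^ 2 by field_simp,
    div_le_iff₀ (by positivity)]
  linarith

theorem HasExpTypeAtMost.sub {t : ℝ} {f g : ℂ → ℂ} (hf : HasExpTypeAtMost t f)
    (hg : HasExpTypeAtMost t g) : HasExpTypeAtMost t (fun z => f z - g z) := fun ε hε => by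
  obtain ⟨C, hC⟩ := hf ε hε
  obtain ⟨D, hD⟩ := hg ε hε
  exact ⟨C + D, fun z => by linarith [norm_sub_le (f z) (g z), hC z, hD z]⟩

theorem IsPW1.sub {f g : ℂ → ℂ} (hf : IsPW1 f) (hg : IsPW1 g) : IsPW1 (fun z => f z - g z) :=
  ⟨hf.1.sub hg.1, hf.2.1.sub hg.2.1, hf.2.2.sub hg.2.2⟩

theorem IsPW1.comp_neg {f : ℂ → ℂ} (hf : IsPW1 f) : IsPW1 (fun z => f (-z)) :=
  ⟨hf.1.comp differentiable_neg, hf.2.1.comp_neg, by simpa using hf.2.2.comp_neg⟩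

/-- The odd parts of Paley-Wiener functions are summable over separated sets in a strip. -/
theorem exists_tsum_sub_neg_bound {S : Set ℂ} {H ρ : ℝ} (hH : 0 ≤ H) (hρ : 0 < ρ)
    (hS : ∀ μ ∈ S, |μ.im| ≤ H) (hsep : ∀ μ ∈ S, ∀ ν ∈ S, μ ≠ ν → 2 * ρ ≤ ‖μ - ν‖) :
    ∃ K : ℝ, ∀ f : ℂ → ℂ, IsPW1 f → Summable (fun μ : S => f μ - f (-μ)) ∧
      ‖∑' μ : S, (f μ - f (-μ))‖ ≤ K * ∫ x : ℝ, ‖f x‖ := by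
  obtain ⟨K, hK0, hK⟩ := sum_norm_le_of_separated Real.pi_pos.le hH hρ
  have key : ∀ f : ℂ → ℂ, IsPW1 f → ∀ F : Finset S, ∑ μ ∈ F, ‖f μ‖ ≤ K * ∫ x : ℝ, ‖f x‖ := by
    intro f hf F
    have := hK f hf.1 hf.2.1 hf.2.2 (F.map (Function.Embedding.subtype _))
      (by simp only [Finset.mem_map]; rintro _ ⟨μ, _, rfl⟩; exact hS _ μ.2)
      (by
        simp only [Finset.mem_map]
        rintro _ ⟨μ, _, rfl⟩ _ ⟨ν, _, rfl⟩ hne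
        exact hsep _ μ.2 _ ν.2 hne)
    rwa [Finset.sum_map] at this
  refine ⟨2 * K, fun f hf => ?_⟩
  have hb : ∀ F : Finset S, ∑ μ ∈ F, ‖f μ - f (-μ)‖ ≤ 2 * K * ∫ x : ℝ, ‖f x‖ := by
    intro F
    have h1 := key f hf F
    have h2 := key _ hf.comp_neg F
    have h3 : ∫ x : ℝ, ‖f (-(x : ℂ))‖ = ∫ x : ℝ, ‖f x‖ := by
      simpa using integral_neg_eq_self (fun x : ℝ => ‖f x‖) volume
    rw [h3] at h2
    calc ∑ μ ∈ F, ‖f μ - f (-μ)‖ ≤ ∑ μ ∈ F, (‖f μ‖ + ‖f (-μ)‖) :=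
          Finset.sum_le_sum fun μ _ => norm_sub_le _ _
      _ ≤ 2 * K * ∫ x : ℝ, ‖f x‖ := by
          rw [Finset.sum_add_distrib]
          linarith
  have hs : Summable fun μ : S => ‖f μ - f (-μ)‖ :=
    summable_of_sum_le (fun _ => norm_nonneg _) hb
  exact ⟨hs.of_norm, (norm_tsum_le_tsum_norm hs).trans (hs.tsum_le_of_sum_le hb)⟩

/-! ### The summation formula -/

/-- `HasSum` over the zero set is unconditional, hence absolute, convergence in ℂ. The weight
`analyticOrderNatAt` counts multiplicity and turns out to be 1 at every zero. -/
theorem mainTheorem6 (a : ℂ) (ha : a ≠ 0) (g : ℂ → ℂ)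
    (hg : IsEigenfunction a ((Real.pi : ℂ) / 2) g) :
    ∃ G : ℂ → ℂ, Differentiable ℂ G ∧ G =ᶠ[𝓝 0] g ∧
      ∀ f : ℂ → ℂ, IsPW1 f →
        HasSum (fun μ : {w : ℂ // G w = 0} =>
            (analyticOrderNatAt G (μ : ℂ) : ℂ) * (f (μ : ℂ) - f (-(μ : ℂ))))
          (a * deriv f 0) := by
  obtain ⟨G, hG, hGg⟩ := hg.exists_entire
  refine ⟨G, hG, hGg, fun f hf => ?_⟩
  have h0 : G 0 ≠ 0 := by
    rw [hGg.self_of_nhds]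
    exact hg.apply_zero_ne ha
  obtain ⟨ev, hode⟩ := hg.entire_ode hG hGg
  rw [show (Real.pi : ℂ) / 2 = ((Real.pi / 2 : ℝ) : ℂ) by push_cast; rfl] at hode
  have hb : 0 < Real.pi / 2 := by positivity
  have hu := isModifiedSolution_of_entire_ode hG hode
  have hW := wronskian_const hG hode
  have hw0 : a * G 0 ^ 2 ≠ 0 := mul_ne_zero ha (pow_ne_zero 2 h0)
  have hw := fun (z : ℂ) (hz : z ≠ 0) => wronskian_modified hG hode rfl hz
  obtain ⟨p, q, C, hA⟩ := hu.exists_hasAmplitudes hb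
  have hq := hu.incoming_ne_zero hb hA (by simp) hw0 hw
  have hp := hu.outgoing_ne_zero hb hA (by simp) hw0 hw
  obtain ⟨H, c, hH, hc, hlow⟩ := hA.exists_lower_bound hb hp hq
  obtain ⟨R, c', hR, hc', hcirc⟩ := hu.exists_circles hA hp hq
  obtain ⟨ρ, hρ, hsep⟩ := hu.exists_separation hb hw0 hw (H := H)
  have hstrip : ∀ μ : ℂ, G μ = 0 → |μ.im| ≤ H := by
    intro μ hμ
    by_contra! hlt
    have := hlow μ hlt.le
    rw [hμ, mul_zero, norm_zero] at this
    exact absurd this (not_le.2 (by positivity))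
  have hne : ∀ μ : ℂ, G μ = 0 → μ ≠ 0 := by
    rintro μ hμ rfl
    exact h0 hμ
  obtain ⟨K, hK⟩ := exists_tsum_sub_neg_bound (S := {w | G w = 0}) hH.le hρ hstrip
    fun μ hμ ν hν => hsep μ ν (hne μ hμ) (mul_eq_zero_of_right μ hμ)
      (mul_eq_zero_of_right ν hν) (hstrip μ hμ) (hstrip ν hν)
  have hord : ∀ μ : ℂ, G μ = 0 → analyticOrderNatAt G μ = 1 := by
    intro μ hμ
    rw [analyticOrderNatAt, (hG.analyticAt μ).analyticOrderAt_eq_one_of_zero_deriv_ne_zero hμ]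
    · rfl
    · intro hd
      refine hw0 ?_
      rw [← hW μ, hμ, hd]
      ring
  -- The formula holds for the approximants through exhaustion by discs. The difference of the zero
  -- sums of `F n` and f is at most K times the L¹ distance, and the derivatives at 0 converge.
  have hsum : ∑' μ : {w | G w = 0}, (f μ - f (-μ)) = a * deriv f 0 := by
    obtain ⟨F, hF, hFM, hF1, hF0⟩ := hf.exists_approx
    have hFsum : ∀ n, ∑' μ : {w | G w = 0}, (F n μ - F n (-μ)) = a * deriv (F n) 0 := by
      intro n
      obtain ⟨M, hM⟩ := hFM n
      exact tendsto_nhds_unique ((hK _ (hF n)).1.hasSum.comp (tendsto_zerosIn hG h0 hR))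
        (tendsto_sum_zerosIn hG h0 ha hW hR hc' hcirc (hF n).1 hM)
    refine tendsto_nhds_unique (f := fun n => ∑' μ : {w | G w = 0}, (F n μ - F n (-μ)))
      (l := atTop) ?_ ?_
    · rw [tendsto_iff_norm_sub_tendsto_zero]
      refine squeeze_zero (fun _ => norm_nonneg _) (fun n => ?_) (by simpa using hF1.const_mul K)
      rw [← (hK _ (hF n)).1.tsum_sub (hK _ hf).1]
      refine (le_of_eq (congrArg norm (tsum_congr fun μ => ?_))).trans (hK _ ((hF n).sub hf)).2
      ring
    · simp only [hFsum]
      exact hF0.const_mul a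
  have := (hK f hf).1.hasSum
  rw [hsum] at this
  rw [show (fun μ : {w : ℂ // G w = 0} => (analyticOrderNatAt G (μ : ℂ) : ℂ) *
    (f (μ : ℂ) - f (-(μ : ℂ)))) = fun μ : {w : ℂ // G w = 0} => f (μ : ℂ) - f (-(μ : ℂ)) from
      funext fun μ => by rw [hord _ μ.2, Nat.cast_one, one_mul]]
  exact this
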